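/- Let $\Omega\subset\mathbb R^d$ be a non-empty bounded convex open set, $\mu$ the Lebesgue measure on $\Omega$, $\sigma$ a Borel probability measure on $\mathbb R^d$ with $\int\|Y\|^2\,d\sigma(Y)<\infty$, and let $f\neq 0$, $g>0$, $\varepsilon>0$ be real. Put $K_\varepsilon(X,Y)=e^{-\|X-Y\|^2/(2\varepsilon)}$, and let $W_0$ be the principal branch of the Lambert function ($W_0(z)e^{W_0(z)}=z$, $W_0(z)\ge -1$). For $\varphi\in C(\Omega)$, $\psi\in C(\mathbb R^d)$ let $$\mathcal D_{\sigma,\varepsilon}(\varphi,\psi)=\int\psi\,d\sigma-\frac{f^2}{2g}\int_\Omega\varphi^2\,d\mu-\varepsilon\int_{\Omega\times\mathbb R^d}\Big(e^{(\varphi(X)+\psi(Y))/\varepsilon}K_\varepsilon(X,Y)-1\Big)d\mu(X)\,d\sigma(Y),$$ and for $h:\Omega\to\mathbb R$ let $$\mathrm{OT}_\varepsilon(\sigma,h\mu)=\sup_{\varphi\in C(\Omega),\,\psi\in C(\mathbb R^d)}\ \int\psi\,d\sigma+\int_\Omega\varphi h\,d\mu-\varepsilon\int_{\Omega\times\mathbb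 R^d}\Big(e^{(\varphi(X)+\psi(Y))/\varepsilon}K_\varepsilon(X,Y)-1\Big)d\mu(X)\,d\sigma(Y),$$ where both objectives are set to $-\infty$ when one of their integrals diverges. Let $$\mathcal E_{\sigma,\varepsilon}(h)=\mathrm{OT}_\varepsilon(\sigma,h\mu)+\frac{g}{2f^2}\int_\Omega h^2\,d\mu\ \text{ if } h\in L^2(\mu),\qquad \mathcal E_{\sigma,\varepsilon}(h)=+\infty\ \text{ otherwise.}$$ Then there is a maximiser $(\varphi_\varepsilon,\psi_\varepsilon)$ of $\mathcal D_{\sigma,\varepsilon}$ over $C(\Omega)\times C(\mathbb R^d)$. It is unique in the sense that every maximiser $(\varphi,\psi)$ satisfies $\varphi=\varphi_\varepsilon$ on $\Omega$ and $\psi=\psi_\varepsilon$ on $\operatorname{supp}\sigma$. It can be chosen, in exactly one way, so that the two equations in (i) hold for all $Y\in\mathbb R^d$ and all $X\in\Omega$; with this choice: (i) $(\varphi_\varepsilon,\psi_\varepsilon)$ is the only pair in $C(\Omega)\times C(\mathbb R^d)$ with $$\psi_\varepsilon(Y)=-\varepsilon\log\Big(\int_\Omega e^{\varphi_\varepsilon(X)/\varepsilon}K_\varepsilon(X,Y)\,d\mu(X)\Big)\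 \ \forall\, Y\in\mathbb R^d,$$ $$\varphi_\varepsilon(X)=-\varepsilon\,W_0\Big(\frac{g}{\varepsilon f^2}\int_{\mathbb R^d}e^{\psi_\varepsilon(Y)/\varepsilon}K_\varepsilon(X,Y)\,d\sigma(Y)\Big)\ \ \forall\, X\in\Omega.$$ Moreover, a pair $(\varphi,\psi)\in C(\Omega)\times C(\mathbb R^d)$ maximises $\mathcal D_{\sigma,\varepsilon}$ if and only if it satisfies the first equation for all $Y\in\operatorname{supp}\sigma$ and the second for all $X\in\Omega$. (ii) Let $h_\varepsilon=-\frac{f^2}{g}\varphi_\varepsilon$. Then $h_\varepsilon\ge 0$, $\int_\Omega h_\varepsilon\,d\mu=1$, the pair $(\varphi_\varepsilon,\psi_\varepsilon)$ attains the supremum defining $\mathrm{OT}_\varepsilon(\sigma,h_\varepsilon\mu)$, and $h_\varepsilon$ is, up to $\mu$-null sets, the unique minimiser of $\mathcal E_{\sigma,\varepsilon}$ among all functions $h:\Omega\to\mathbb R$ (hence also among probability densities). (iii) $\psi_\varepsilon$ is differentiable and, for every $Y\in\mathbb R^d$, $$\nabla\psi_\varepsilon(Y)=Y-\int_\Omega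 X\,e^{(\varphi_\varepsilon(X)+\psi_\varepsilon(Y))/\varepsilon}K_\varepsilon(X,Y)\,d\mu(X),\qquad \int_\Omega e^{(\varphi_\varepsilon(X)+\psi_\varepsilon(Y))/\varepsilon}K_\varepsilon(X,Y)\,d\mu(X)=1.$$ The plan $d\gamma_\varepsilon(X,Y)=e^{(\varphi_\varepsilon(X)+\psi_\varepsilon(Y))/\varepsilon}K_\varepsilon(X,Y)\,d\mu(X)\,d\sigma(Y)$ has second marginal $\sigma$, and $T_\varepsilon(Y)=Y-\nabla\psi_\varepsilon(Y)$ is its barycentric map: $T_\varepsilon$ is $\sigma$-integrable and $\int_B T_\varepsilon\,d\sigma=\int_{\Omega\times B}X\,d\gamma_\varepsilon(X,Y)$ for every Borel set $B\subset\mathbb R^d$. -/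

import Mathlib

open MeasureTheory

namespace EntropicSWSG

noncomputable section

/-- The principal branch `W₀` of the Lambert function: for `z ≥ -e⁻¹`, `lambertW0 z` is the unique
`w ≥ -1` with `w * exp w = z`. -/
def lambertW0 (z : ℝ) : ℝ :=
  Function.invFunOn (fun w : ℝ => w * Real.exp w) (Set.Ici (-1)) z

/-- On the range used below (`z ≥ 0`), `lambertW0` takes values in `[-1, ∞)` and inverts
`w ↦ w * exp w`. -/
theorem lambertW0_spec {z : ℝ} (hz : 0 ≤ z) :
    -1 ≤ lambertW0 z ∧ lambertW0 z * Real.exp (lambertW0 z) = z := by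
  have hex : ∃ w ∈ Set.Ici (-1 : ℝ), (fun w : ℝ => w * Real.exp w) w = z := by
    have hc : ContinuousOn (fun w : ℝ => w * Real.exp w) (Set.Icc 0 z) := by fun_prop
    have hmem : z ∈ Set.Icc ((fun w : ℝ => w * Real.exp w) 0)
        ((fun w : ℝ => w * Real.exp w) z) := by
      refine ⟨by simpa using hz, ?_⟩
      have h1 : (1 : ℝ) ≤ Real.exp z := Real.one_le_exp hz
      simpa using mul_le_mul_of_nonneg_left h1 hz
    obtain ⟨w, hw, hwz⟩ := intermediate_value_Icc hz hc hmem
    exact ⟨w, by have := hw.1; simp only [Set.mem_Ici]; linarith, hwz⟩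
  exact ⟨Function.invFunOn_mem hex, Function.invFunOn_eq hex⟩

/-- The equation `w * exp w = z` has at most one solution `w ≥ 0`. -/
theorem lambertW0_unique {w : ℝ} (hw : 0 ≤ w) : lambertW0 (w * Real.exp w) = w := by
  obtain ⟨-, h2⟩ := lambertW0_spec (mul_nonneg hw (Real.exp_pos w).le)
  have hpos : 0 ≤ lambertW0 (w * Real.exp w) := by
    by_contra hneg
    have := mul_neg_of_neg_of_pos (not_le.1 hneg) (Real.exp_pos (lambertW0 (w * Real.exp w)))
    have := mul_nonneg hw (Real.exp_pos w).le
    linarith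
  have mono : ∀ a b : ℝ, 0 ≤ a → a < b → a * Real.exp a < b * Real.exp b := fun a b ha hab =>
    mul_lt_mul hab (Real.exp_le_exp.2 hab.le) (Real.exp_pos a) (ha.trans hab.le)
  rcases lt_trichotomy (lambertW0 (w * Real.exp w)) w with h | h | h
  · exact absurd h2 (mono _ _ hpos h).ne
  · exact h
  · exact absurd h2 (mono _ _ hw h).ne'

variable {d : ℕ} {Ω : Set (EuclideanSpace ℝ (Fin d))}

/-- The Lebesgue measure on `Ω`, as a measure on the subtype `Ω`. -/
def lebesgueOn (Ω : Set (EuclideanSpace ℝ (Fin d))) : Measure Ω :=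
  (volume : Measure (EuclideanSpace ℝ (Fin d))).comap Subtype.val

/-- The Gibbs kernel of the quadratic cost `‖X - Y‖² / 2` at temperature `ε`. -/
def gibbsKernel (ε : ℝ) (X Y : EuclideanSpace ℝ (Fin d)) : ℝ :=
  Real.exp (-(‖X - Y‖ ^ 2 / (2 * ε)))

/-- The density `exp ((φ(X) + ψ(Y)) / ε) K_ε(X, Y)` with respect to `μ ⊗ σ`. -/
def planDensity (ε : ℝ) (φ : C(Ω, ℝ)) (ψ : C(EuclideanSpace ℝ (Fin d), ℝ))
    (X : Ω) (Y : EuclideanSpace ℝ (Fin d)) : ℝ :=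
  Real.exp ((φ X + ψ Y) / ε) * gibbsKernel ε X Y

open Classical in
/-- The entropy-regularised dual objective. The value is `-∞` at the pairs for which one of the
integrals diverges. -/
def dualObjective (σ : Measure (EuclideanSpace ℝ (Fin d))) (f g ε : ℝ)
    (φ : C(Ω, ℝ)) (ψ : C(EuclideanSpace ℝ (Fin d), ℝ)) : EReal :=
  if Integrable (fun Y => ψ Y) σ ∧ Integrable (fun X => φ X ^ 2) (lebesgueOn Ω) ∧
      Integrable (fun p : Ω × EuclideanSpace ℝ (Fin d) => planDensity ε φ ψ p.1 p.2 - 1)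
        ((lebesgueOn Ω).prod σ) then
    (((∫ Y, ψ Y ∂σ) - f ^ 2 / (2 * g) * (∫ X, φ X ^ 2 ∂(lebesgueOn Ω))
      - ε * ∫ p : Ω × EuclideanSpace ℝ (Fin d), (planDensity ε φ ψ p.1 p.2 - 1)
          ∂((lebesgueOn Ω).prod σ) : ℝ) : EReal)
  else ⊥

/-- `(φ, ψ)` maximises the regularised dual objective over `C(Ω) × C(ℝᵈ)`. -/
def IsDualMaximiser (σ : Measure (EuclideanSpace ℝ (Fin d))) (f g ε : ℝ)
    (φ : C(Ω, ℝ)) (ψ : C(EuclideanSpace ℝ (Fin d), ℝ)) : Prop :=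
  ∀ (φ' : C(Ω, ℝ)) (ψ' : C(EuclideanSpace ℝ (Fin d), ℝ)),
    dualObjective σ f g ε φ' ψ' ≤ dualObjective σ f g ε φ ψ

/-- The log-sum-exp equation for `ψ` at the point `Y`. -/
def LogSumExpEquation (ε : ℝ) (φ : C(Ω, ℝ)) (ψ : C(EuclideanSpace ℝ (Fin d), ℝ))
    (Y : EuclideanSpace ℝ (Fin d)) : Prop :=
  ψ Y = -ε * Real.log (∫ X : Ω, Real.exp (φ X / ε) * gibbsKernel ε X Y ∂(lebesgueOn Ω))

/-- The Lambert equation for `φ` at the point `X`. -/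
def LambertEquation (σ : Measure (EuclideanSpace ℝ (Fin d))) (f g ε : ℝ)
    (φ : C(Ω, ℝ)) (ψ : C(EuclideanSpace ℝ (Fin d), ℝ)) (X : Ω) : Prop :=
  φ X = -ε * lambertW0 (g / (ε * f ^ 2) * ∫ Y, Real.exp (ψ Y / ε) * gibbsKernel ε X Y ∂σ)

open Classical in
/-- The objective of the dual formulation of entropic optimal transport between `h μ` and `σ`.
The value is `-∞` at the pairs for which one of the integrals diverges. -/
def otObjective (σ : Measure (EuclideanSpace ℝ (Fin d))) (ε : ℝ) (h : Ω → ℝ)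
    (φ : C(Ω, ℝ)) (ψ : C(EuclideanSpace ℝ (Fin d), ℝ)) : EReal :=
  if Integrable (fun Y => ψ Y) σ ∧ Integrable (fun X => φ X * h X) (lebesgueOn Ω) ∧
      Integrable (fun p : Ω × EuclideanSpace ℝ (Fin d) => planDensity ε φ ψ p.1 p.2 - 1)
        ((lebesgueOn Ω).prod σ) then
    (((∫ Y, ψ Y ∂σ) + (∫ X, φ X * h X ∂(lebesgueOn Ω))
      - ε * ∫ p : Ω × EuclideanSpace ℝ (Fin d), (planDensity ε φ ψ p.1 p.2 - 1)
          ∂((lebesgueOn Ω).prod σ) : ℝ) : EReal)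
  else ⊥

/-- The entropic transport cost `OT_ε(σ, h μ)`. -/
def entropicOT (σ : Measure (EuclideanSpace ℝ (Fin d))) (ε : ℝ) (h : Ω → ℝ) : EReal :=
  ⨆ (φ : C(Ω, ℝ)) (ψ : C(EuclideanSpace ℝ (Fin d), ℝ)), otObjective σ ε h φ ψ

open Classical in
/-- The regularised total energy `OT_ε(σ, h μ) + g / (2 f²) ∫ h² dμ`, equal to `+∞` when `h` is
not square integrable. -/
def primalEnergy (σ : Measure (EuclideanSpace ℝ (Fin d))) (f g ε : ℝ) (h : Ω → ℝ) : EReal :=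
  if MemLp h 2 (lebesgueOn Ω) then
    entropicOT σ ε h + ((g / (2 * f ^ 2) * ∫ X, h X ^ 2 ∂(lebesgueOn Ω) : ℝ) : EReal)
  else ⊤

/-- The entropic water height `h = -(f² / g) φ`. -/
def waterHeight (f g : ℝ) (φ : C(Ω, ℝ)) (X : Ω) : ℝ := -(f ^ 2 / g) * φ X

/-- The entropic plan, with density `planDensity` with respect to `μ ⊗ σ`. -/
def entropicPlan (σ : Measure (EuclideanSpace ℝ (Fin d))) (ε : ℝ)
    (φ : C(Ω, ℝ)) (ψ : C(EuclideanSpace ℝ (Fin d), ℝ)) :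
    Measure (Ω × EuclideanSpace ℝ (Fin d)) :=
  ((lebesgueOn Ω).prod σ).withDensity fun p => ENNReal.ofReal (planDensity ε φ ψ p.1 p.2)

/-- `T` is the barycentric map of the plan `γ`: `T(Y)` is the mean of `X` under `γ` given `Y`. -/
def IsBarycentricMap (γ : Measure (Ω × EuclideanSpace ℝ (Fin d)))
    (T : EuclideanSpace ℝ (Fin d) → EuclideanSpace ℝ (Fin d)) : Prop :=
  Integrable T γ.snd ∧
    ∀ B : Set (EuclideanSpace ℝ (Fin d)), MeasurableSet B →
      ∫ Y in B, T Y ∂γ.snd = ∫ p in Prod.snd ⁻¹' B, (p.1 : EuclideanSpace ℝ (Fin d)) ∂γ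

/-- `Y ↦ ∫ X exp ((φ(X) + ψ(Y)) / ε) K_ε(X, Y) dμ(X)`. -/
def barycentre (ε : ℝ) (φ : C(Ω, ℝ)) (ψ : C(EuclideanSpace ℝ (Fin d), ℝ))
    (Y : EuclideanSpace ℝ (Fin d)) : EuclideanSpace ℝ (Fin d) :=
  ∫ X : Ω, planDensity ε φ ψ X Y • (X : EuclideanSpace ℝ (Fin d)) ∂(lebesgueOn Ω)

end

end EntropicSWSG

open MeasureTheory

namespace EntropicSWSG

noncomputable section

/-! ### Squared distances in `L²` -/

section SquareIntegrable

variable {α : Type*} [MeasurableSpace α] {μ : Measure α} {u v : α → ℝ}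

/-! Put `κ = f² / g`. For fixed `φ` the best `ψ` is the log-sum-exp of `φ`, which leaves the reduced
functional `J(φ) = -ε ∫ log Z_φ dσ - (κ/2) ∫ φ² dμ`, where `Z_φ(Y) = ∫ exp(φ/ε) K(·, Y) dμ`
(`gibbsMass`, `reducedDual`). It is studied on the nonpositive functions of `L²(μ)`, where `exp(φ/ε)
≤ 1` makes every integral harmless. There `J` is bounded above by Jensen's inequality and strongly
concave (`reducedDual_midpoint`), so maximising sequences are Cauchy, and by continuity `J` attains
its supremum (`exists_isMax_reducedDual`).

The Euler–Lagrange equation is obtained without differentiating `J`. Freeze `G(X) = ∫ K(X, Y) /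
Z_φ(Y) dσ(Y)` at a maximiser `φ`, and let `ρ(X)` minimise `s ↦ ε exp(s/ε) G(X) + κ s²/2`; this `ρ`
is given by the Lambert function. Linearising the logarithm gives `J(ρ) ≥ J(φ) + (κ/2) ‖φ - ρ‖²`,
hence `φ = ρ` almost everywhere (`ae_eq_of_isMax_reducedDual`). Up to a Gaussian factor `G` is a
Laplace transform: finite almost everywhere on the open set `Ω`, hence finite everywhere there,
convex, and so continuous. Thus `ρ` is a continuous version of `φ`, and it solves both equations
pointwise (`exists_solution`).

A solution with `φ ∈ L²` has a plan with marginals `h μ` and `σ`, where `h = -κ φ`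
(`IsEquilibrium`). Against any admissible competitor, the tangent inequality for the exponential
integrates to an exact identity: the dual deficit is `(κ/2) ‖φ' - φ‖²` plus a nonnegative Bregman
term (`dualValue_add`). This gives optimality and uniqueness. The same Bregman term is the deficit
in the transport problem towards `h μ` (`entropicOT_eq`), and testing `OT_ε` at `(φ, ψ)` bounds the
primal energy below by a quadratic with vertex `h` (`add_sq_le_primalEnergy`).

An arbitrary continuous solution of the equations is not known to be in `L²`, so it is identified
with `φ` by a comparison principle (`ae_le_of_marginal_eq`): raising the potential on a set raises
the plan's mass there, whereas the prescribed density `-κ φ` goes down. -/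

theorem integral_sub_sq (hu : MemLp u 2 μ) (hv : MemLp v 2 μ) :
    ∫ x, (u x - v x) ^ 2 ∂μ = ∫ x, u x ^ 2 ∂μ - 2 * (∫ x, u x * v x ∂μ) + ∫ x, v x ^ 2 ∂μ := by
  have i1 := hu.integrable_sq
  have i2 : Integrable (fun x => 2 * (u x * v x)) μ := (hu.integrable_mul hv).const_mul 2
  have i12 : Integrable (fun x => u x ^ 2 - 2 * (u x * v x)) μ := i1.sub i2
  rw [← integral_const_mul, ← integral_sub i1 i2, ← integral_add i12 hv.integrable_sq]
  congr 1 with x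
  ring

theorem ae_eq_of_integral_sub_sq_eq_zero (hu : MemLp u 2 μ) (hv : MemLp v 2 μ)
    (h : ∫ x, (u x - v x) ^ 2 ∂μ = 0) : u =ᵐ[μ] v := by
  have hi : Integrable (fun x => (u x - v x) ^ 2) μ := (hu.sub hv).integrable_sq
  rw [integral_eq_zero_iff_of_nonneg (fun x => sq_nonneg _) hi] at h
  filter_upwards [h] with x hx
  simpa [sub_eq_zero] using hx

end SquareIntegrable

/-! ### Gibbs masses, plan marginals and the comparison principle for a general kernel -/

section AbstractKernel

variable {α β : Type*} [MeasurableSpace α] [MeasurableSpace β]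

/-- A measurable kernel with values in `(0, 1]`, whose logarithm is bounded below by an integrable
function of the second variable. -/
structure IsGibbsLike (σ : Measure β) (K : α → β → ℝ) : Prop where
  measurable : Measurable (Function.uncurry K)
  pos : ∀ x y, 0 < K x y
  le_one : ∀ x y, K x y ≤ 1
  exists_lower : ∃ q : β → ℝ, Integrable q σ ∧ ∀ x y, Real.exp (-q y) ≤ K x y

/-- The total mass of `exp (φ / ε) K(·, y) μ`. -/
def gibbsMass (μ : Measure α) (K : α → β → ℝ) (ε : ℝ) (φ : α → ℝ) (y : β) : ℝ :=
  ∫ x, Real.exp (φ x / ε) * K x y ∂μ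

/-- The average over `σ` of the normalised kernel. -/
def normalisedKernel (μ : Measure α) (σ : Measure β) (K : α → β → ℝ) (ε : ℝ) (φ : α → ℝ)
    (x : α) : ℝ :=
  ∫ y, (gibbsMass μ K ε φ y)⁻¹ * K x y ∂σ

variable {μ : Measure α} {σ : Measure β} {K : α → β → ℝ} {ε : ℝ} {φ φ' : α → ℝ}

theorem IsGibbsLike.measurable_left (hK : IsGibbsLike σ K) (y : β) : Measurable fun x => K x y :=
  hK.measurable.comp (measurable_id.prodMk measurable_const)

theorem exp_div_le_one (hε : 0 < ε) {s : ℝ} (hs : s ≤ 0) : Real.exp (s / ε) ≤ 1 :=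
  Real.exp_le_one_iff.2 (div_nonpos_of_nonpos_of_nonneg hs hε.le)

theorem integrable_exp_div [IsFiniteMeasure μ] (hε : 0 < ε) (hφ : Measurable φ)
    (hφ0 : ∀ x, φ x ≤ 0) : Integrable (fun x => Real.exp (φ x / ε)) μ := by
  refine Integrable.of_bound (by fun_prop) 1 (Filter.Eventually.of_forall fun x => ?_)
  rw [Real.norm_of_nonneg (Real.exp_pos _).le]
  exact exp_div_le_one hε (hφ0 x)

theorem integrable_exp_mul_kernel [IsFiniteMeasure μ] (hK : IsGibbsLike σ K) (hε : 0 < ε)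
    (hφ : Measurable φ) (hφ0 : ∀ x, φ x ≤ 0) (y : β) :
    Integrable (fun x => Real.exp (φ x / ε) * K x y) μ := by
  have := hK.measurable_left y
  refine Integrable.of_bound (by fun_prop) 1 (Filter.Eventually.of_forall fun x => ?_)
  rw [Real.norm_of_nonneg (mul_pos (Real.exp_pos _) (hK.pos x y)).le]
  exact mul_le_one₀ (exp_div_le_one hε (hφ0 x)) (hK.pos x y).le (hK.le_one x y)

theorem gibbsMass_pos [IsFiniteMeasure μ] [NeZero μ] (hK : IsGibbsLike σ K) (hε : 0 < ε)
    (hφ : Measurable φ) (hφ0 : ∀ x, φ x ≤ 0) (y : β) : 0 < gibbsMass μ K ε φ y := by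
  have hpos : ∀ x, 0 < Real.exp (φ x / ε) * K x y := fun x =>
    mul_pos (Real.exp_pos _) (hK.pos x y)
  refine (integral_pos_iff_support_of_nonneg (fun x => (hpos x).le)
    (integrable_exp_mul_kernel hK hε hφ hφ0 y)).2 ?_
  rw [Function.support_eq_univ fun x => (hpos x).ne']
  exact Measure.measure_univ_pos.2 (NeZero.ne μ)

theorem gibbsMass_le [IsFiniteMeasure μ] (hK : IsGibbsLike σ K) (hε : 0 < ε)
    (hφ : Measurable φ) (hφ0 : ∀ x, φ x ≤ 0) (y : β) : gibbsMass μ K ε φ y ≤ μ.real Set.univ := by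
  calc gibbsMass μ K ε φ y ≤ ∫ _, 1 ∂μ :=
        integral_mono (integrable_exp_mul_kernel hK hε hφ hφ0 y) (integrable_const _) fun x =>
          mul_le_one₀ (exp_div_le_one hε (hφ0 x)) (hK.pos x y).le (hK.le_one x y)
    _ = μ.real Set.univ := by simp

theorem exp_neg_mul_le_gibbsMass [IsFiniteMeasure μ] (hK : IsGibbsLike σ K) (hε : 0 < ε)
    (hφ : Measurable φ) (hφ0 : ∀ x, φ x ≤ 0) {q : β → ℝ}
    (hq : ∀ x y, Real.exp (-q y) ≤ K x y) (y : β) :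
    Real.exp (-q y) * ∫ x, Real.exp (φ x / ε) ∂μ ≤ gibbsMass μ K ε φ y := by
  rw [← integral_const_mul]
  refine integral_mono ((integrable_exp_div hε hφ hφ0).const_mul _)
    (integrable_exp_mul_kernel hK hε hφ hφ0 y) fun x => ?_
  have := mul_le_mul_of_nonneg_left (hq x y) (Real.exp_pos (φ x / ε)).le
  simpa [mul_comm] using this

theorem measurable_gibbsMass [SFinite μ] (hK : IsGibbsLike σ K) (hφ : Measurable φ) :
    Measurable (gibbsMass μ K ε φ) := by
  have hm := hK.measurable
  have : Measurable fun p : α × β => Real.exp (φ p.1 / ε) * K p.1 p.2 :=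
    Measurable.mul (by fun_prop) hm
  exact (this.stronglyMeasurable.integral_prod_left' (μ := μ)).measurable

/-- The bound depends on `φ` only through the lower bound `c`, so it serves both for integrability
and as a dominating function along a sequence of potentials. -/
theorem abs_log_gibbsMass_le [IsFiniteMeasure μ] [NeZero μ] (hK : IsGibbsLike σ K) (hε : 0 < ε)
    (hφ : Measurable φ) (hφ0 : ∀ x, φ x ≤ 0) {q : β → ℝ}
    (hq : ∀ x y, Real.exp (-q y) ≤ K x y) {c : ℝ} (hc : 0 < c)
    (hc' : c ≤ ∫ x, Real.exp (φ x / ε) ∂μ) (y : β) :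
    |Real.log (gibbsMass μ K ε φ y)| ≤ |q y| + (|Real.log c| + |Real.log (μ.real Set.univ)|) := by
  have h1 := gibbsMass_pos (μ := μ) hK hε hφ hφ0 y
  have h2 := Real.log_le_log h1 (gibbsMass_le hK hε hφ hφ0 y)
  have h3 : Real.exp (-q y) * c ≤ gibbsMass μ K ε φ y :=
    (mul_le_mul_of_nonneg_left hc' (Real.exp_pos _).le).trans
      (exp_neg_mul_le_gibbsMass hK hε hφ hφ0 hq y)
  have h4 := Real.log_le_log (mul_pos (Real.exp_pos _) hc) h3
  rw [Real.log_mul (Real.exp_pos _).ne' hc.ne', Real.log_exp] at h4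
  rw [abs_le]
  constructor
  · linarith [le_abs_self (q y), neg_abs_le (Real.log c), abs_nonneg (Real.log (μ.real Set.univ))]
  · linarith [abs_nonneg (q y), abs_nonneg (Real.log c), le_abs_self (Real.log (μ.real Set.univ))]

theorem integral_exp_div_pos [IsFiniteMeasure μ] [NeZero μ] (hε : 0 < ε) (hφ : Measurable φ)
    (hφ0 : ∀ x, φ x ≤ 0) : 0 < ∫ x, Real.exp (φ x / ε) ∂μ :=
  integral_exp_pos (integrable_exp_div hε hφ hφ0)

theorem integrable_log_gibbsMass [IsFiniteMeasure μ] [NeZero μ] [IsFiniteMeasure σ]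
    (hK : IsGibbsLike σ K) (hε : 0 < ε) (hφ : Measurable φ) (hφ0 : ∀ x, φ x ≤ 0) :
    Integrable (fun y => Real.log (gibbsMass μ K ε φ y)) σ := by
  obtain ⟨q, hqi, hq⟩ := hK.exists_lower
  have hm := measurable_gibbsMass (μ := μ) (ε := ε) hK hφ
  exact Integrable.mono' (hqi.abs.add (integrable_const _))
    (Real.measurable_log.comp hm).aestronglyMeasurable (Filter.Eventually.of_forall
      (abs_log_gibbsMass_le hK hε hφ hφ0 hq (integral_exp_div_pos hε hφ hφ0) le_rfl))

theorem measurable_normalised_prod [SFinite μ] (hK : IsGibbsLike σ K) (hφ : Measurable φ)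
    (hφ' : Measurable φ') :
    Measurable fun p : α × β =>
      Real.exp (φ' p.1 / ε) * ((gibbsMass μ K ε φ p.2)⁻¹ * K p.1 p.2) := by
  have hm := hK.measurable
  have hm2 := measurable_gibbsMass (μ := μ) (ε := ε) hK hφ
  refine Measurable.mul (by fun_prop) (Measurable.mul ?_ hm)
  exact (hm2.comp measurable_snd).inv

omit [MeasurableSpace β] in
theorem integral_normalised_eq_div (y : β) (A : Set α) :
    ∫ x in A, Real.exp (φ' x / ε) * ((gibbsMass μ K ε φ y)⁻¹ * K x y) ∂μ =
      (∫ x in A, Real.exp (φ' x / ε) * K x y ∂μ) / gibbsMass μ K ε φ y := by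
  rw [div_eq_inv_mul, ← integral_const_mul]
  congr 1 with x
  ring

theorem integral_normalised_eq_one [IsFiniteMeasure μ] [NeZero μ] (hK : IsGibbsLike σ K)
    (hε : 0 < ε) (hφ : Measurable φ) (hφ0 : ∀ x, φ x ≤ 0) (y : β) :
    ∫ x, Real.exp (φ x / ε) * ((gibbsMass μ K ε φ y)⁻¹ * K x y) ∂μ = 1 := by
  have := integral_normalised_eq_div (μ := μ) (K := K) (ε := ε) (φ := φ) (φ' := φ) y Set.univ
  rw [setIntegral_univ, setIntegral_univ] at this
  rw [this]
  exact div_self (gibbsMass_pos hK hε hφ hφ0 y).ne'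

/-- The integrand is positive and each section in `x` has mass one, so its total mass is that of
`σ`. -/
theorem integrable_normalised_prod [IsFiniteMeasure μ] [NeZero μ] [IsFiniteMeasure σ]
    (hK : IsGibbsLike σ K) (hε : 0 < ε) (hφ : Measurable φ) (hφ0 : ∀ x, φ x ≤ 0) :
    Integrable (fun p : α × β =>
      Real.exp (φ p.1 / ε) * ((gibbsMass μ K ε φ p.2)⁻¹ * K p.1 p.2)) (μ.prod σ) := by
  refine (integrable_prod_iff'
    (measurable_normalised_prod hK hφ hφ).aestronglyMeasurable).2 ⟨?_, ?_⟩
  · refine Filter.Eventually.of_forall fun y => ?_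
    refine ((integrable_exp_mul_kernel (μ := μ) hK hε hφ hφ0 y).const_mul
      (gibbsMass μ K ε φ y)⁻¹).congr (Filter.Eventually.of_forall fun x => ?_)
    simp only
    ring
  · refine (integrable_const (1 : ℝ)).congr (Filter.Eventually.of_forall fun y => ?_)
    simp only
    rw [← integral_normalised_eq_one (μ := μ) hK hε hφ hφ0 y]
    congr 1 with x
    rw [Real.norm_of_nonneg]
    have := (gibbsMass_pos (μ := μ) hK hε hφ hφ0 y).le
    have := (hK.pos x y).le
    positivity

theorem integrable_normalised_prod_restrict [IsFiniteMeasure μ] [NeZero μ] [IsFiniteMeasure σ]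
    (hK : IsGibbsLike σ K) (hε : 0 < ε) (hφ : Measurable φ) (hφ0 : ∀ x, φ x ≤ 0) (A : Set α) :
    Integrable (fun p : α × β =>
      Real.exp (φ p.1 / ε) * ((gibbsMass μ K ε φ p.2)⁻¹ * K p.1 p.2))
        ((μ.restrict A).prod σ) := by
  have := (integrable_normalised_prod (μ := μ) hK hε hφ hφ0).integrableOn
    (s := A ×ˢ (Set.univ : Set β))
  rwa [IntegrableOn, ← Measure.prod_restrict, Measure.restrict_univ] at this

theorem ae_integrable_normalisedKernel [IsFiniteMeasure μ] [NeZero μ] [IsFiniteMeasure σ]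
    (hK : IsGibbsLike σ K) (hε : 0 < ε) (hφ : Measurable φ) (hφ0 : ∀ x, φ x ≤ 0) :
    ∀ᵐ x ∂μ, Integrable (fun y => (gibbsMass μ K ε φ y)⁻¹ * K x y) σ := by
  filter_upwards [(integrable_normalised_prod (μ := μ) hK hε hφ hφ0).prod_right_ae] with x hx
  exact (integrable_const_mul_iff (isUnit_iff_ne_zero.2 (Real.exp_pos _).ne') _).1 hx

theorem normalisedKernel_nonneg [IsFiniteMeasure μ] [NeZero μ] (hK : IsGibbsLike σ K)
    (hε : 0 < ε) (hφ : Measurable φ) (hφ0 : ∀ x, φ x ≤ 0) (x : α) :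
    0 ≤ normalisedKernel μ σ K ε φ x :=
  integral_nonneg fun y =>
    mul_nonneg (inv_nonneg.2 (gibbsMass_pos hK hε hφ hφ0 y).le) (hK.pos x y).le

theorem integrable_exp_mul_normalisedKernel [IsFiniteMeasure μ] [NeZero μ] [IsFiniteMeasure σ]
    (hK : IsGibbsLike σ K) (hε : 0 < ε) (hφ : Measurable φ) (hφ0 : ∀ x, φ x ≤ 0) :
    Integrable (fun x => Real.exp (φ x / ε) * normalisedKernel μ σ K ε φ x) μ := by
  have := (integrable_normalised_prod (μ := μ) hK hε hφ hφ0).integral_prod_left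
  simpa only [normalisedKernel, integral_const_mul] using this

/-- The `μ`-integral over `A` of the first marginal of the plan is the `σ`-integral of the
conditional masses of `A`. -/
theorem setIntegral_exp_mul_normalisedKernel [IsFiniteMeasure μ] [NeZero μ] [IsFiniteMeasure σ]
    (hK : IsGibbsLike σ K) (hε : 0 < ε) (hφ : Measurable φ) (hφ0 : ∀ x, φ x ≤ 0) (A : Set α) :
    ∫ x in A, Real.exp (φ x / ε) * normalisedKernel μ σ K ε φ x ∂μ =
      ∫ y, (∫ x in A, Real.exp (φ x / ε) * K x y ∂μ) / gibbsMass μ K ε φ y ∂σ := by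
  have hint := integrable_normalised_prod_restrict (μ := μ) hK hε hφ hφ0 A
  have := integral_integral_swap (f := fun x y =>
    Real.exp (φ x / ε) * ((gibbsMass μ K ε φ y)⁻¹ * K x y)) hint
  simp only [integral_const_mul] at this
  refine this.trans ?_
  congr 1 with y
  exact integral_normalised_eq_div y A

/-- Tilting by an increasing function of `φ - φ'` increases the mass of `{φ > φ'}`. -/
theorem conditional_mass_mono [IsFiniteMeasure μ] [NeZero μ] (hK : IsGibbsLike σ K) (hε : 0 < ε)
    (hφ : Measurable φ) (hφ0 : ∀ x, φ x ≤ 0) (hφ' : Measurable φ') (hφ'0 : ∀ x, φ' x ≤ 0)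
    (y : β) :
    (∫ x in {x | φ' x < φ x}, Real.exp (φ' x / ε) * K x y ∂μ) / gibbsMass μ K ε φ' y ≤
      (∫ x in {x | φ' x < φ x}, Real.exp (φ x / ε) * K x y ∂μ) / gibbsMass μ K ε φ y := by
  have hA : MeasurableSet {x | φ' x < φ x} := measurableSet_lt hφ' hφ
  set A := {x | φ' x < φ x}
  have hi := integrable_exp_mul_kernel (μ := μ) hK hε hφ hφ0 y
  have hi' := integrable_exp_mul_kernel (μ := μ) hK hε hφ' hφ'0 y
  have hp := gibbsMass_pos (μ := μ) hK hε hφ hφ0 y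
  have hp' := gibbsMass_pos (μ := μ) hK hε hφ' hφ'0 y
  have hs := integral_add_compl hA hi
  have hs' := integral_add_compl hA hi'
  have h1 : ∫ x in A, Real.exp (φ' x / ε) * K x y ∂μ ≤ ∫ x in A, Real.exp (φ x / ε) * K x y ∂μ := by
    refine setIntegral_mono_on hi'.integrableOn hi.integrableOn hA fun x hx => ?_
    have : φ' x < φ x := hx
    have := hK.pos x y
    gcongr
  have h2 : ∫ x in Aᶜ, Real.exp (φ x / ε) * K x y ∂μ ≤
      ∫ x in Aᶜ, Real.exp (φ' x / ε) * K x y ∂μ := by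
    refine setIntegral_mono_on hi.integrableOn hi'.integrableOn hA.compl fun x hx => ?_
    have : φ x ≤ φ' x := not_lt.1 hx
    have := hK.pos x y
    gcongr
  have h3 : ∀ (ρ : α → ℝ) (B : Set α), 0 ≤ ∫ x in B, Real.exp (ρ x / ε) * K x y ∂μ :=
    fun ρ B => integral_nonneg fun x => mul_nonneg (Real.exp_pos _).le (hK.pos x y).le
  -- After clearing denominators and splitting both masses over `A` and `Aᶜ`, the terms in `A`
  -- cancel and what is left is the product of `h1` and `h2`.
  rw [div_le_div_iff₀ hp' hp]
  simp only [gibbsMass]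
  rw [← hs, ← hs']
  have := mul_le_mul h1 h2 (h3 φ Aᶜ) (h3 φ A)
  nlinarith

/-- On `A = {φ' < φ}` the plan of `φ` puts at least as much mass as that of `φ'`, by
`conditional_mass_mono`. The equations turn these masses into `∫_A -κ φ` and `∫_A -κ φ'`, which are
ordered strictly the other way unless `A` is null. No square integrability enters. -/
theorem ae_le_of_marginal_eq [IsFiniteMeasure μ] [NeZero μ] [IsFiniteMeasure σ]
    (hK : IsGibbsLike σ K) (hε : 0 < ε) {κ : ℝ} (hκ : 0 < κ)
    (hφ : Measurable φ) (hφ0 : ∀ x, φ x ≤ 0) (hφ' : Measurable φ') (hφ'0 : ∀ x, φ' x ≤ 0)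
    (h : ∀ᵐ x ∂μ, Real.exp (φ x / ε) * normalisedKernel μ σ K ε φ x = -κ * φ x)
    (h' : ∀ᵐ x ∂μ, Real.exp (φ' x / ε) * normalisedKernel μ σ K ε φ' x = -κ * φ' x) :
    ∀ᵐ x ∂μ, φ x ≤ φ' x := by
  have hA : MeasurableSet {x | φ' x < φ x} := measurableSet_lt hφ' hφ
  have hle : ∫ x in {x | φ' x < φ x}, Real.exp (φ' x / ε) * normalisedKernel μ σ K ε φ' x ∂μ ≤
      ∫ x in {x | φ' x < φ x}, Real.exp (φ x / ε) * normalisedKernel μ σ K ε φ x ∂μ := by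
    rw [setIntegral_exp_mul_normalisedKernel hK hε hφ hφ0,
      setIntegral_exp_mul_normalisedKernel hK hε hφ' hφ'0]
    have key : ∀ ρ : α → ℝ, Measurable ρ → (∀ x, ρ x ≤ 0) → Integrable (fun y =>
        (∫ x in {x | φ' x < φ x}, Real.exp (ρ x / ε) * K x y ∂μ) / gibbsMass μ K ε ρ y) σ := by
      intro ρ hρ hρ0
      have := (integrable_normalised_prod_restrict (μ := μ) hK hε hρ hρ0
        {x | φ' x < φ x}).integral_prod_right
      simpa only [integral_normalised_eq_div] using this
    exact integral_mono (key φ' hφ' hφ'0) (key φ hφ hφ0) fun y =>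
      conditional_mass_mono hK hε hφ hφ0 hφ' hφ'0 y
  have hi : Integrable (fun x => -κ * φ x) μ :=
    (integrable_exp_mul_normalisedKernel (μ := μ) hK hε hφ hφ0).congr h
  have hi' : Integrable (fun x => -κ * φ' x) μ :=
    (integrable_exp_mul_normalisedKernel (μ := μ) hK hε hφ' hφ'0).congr h'
  rw [integral_congr_ae (ae_restrict_of_ae h), integral_congr_ae (ae_restrict_of_ae h'),
    ← sub_nonneg, ← integral_sub hi.integrableOn hi'.integrableOn] at hle
  have hle2 : ∫ x in {x | φ' x < φ x}, κ * (φ x - φ' x) ∂μ ≤ 0 := by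
    rw [← neg_nonneg, ← integral_neg]
    refine hle.trans_eq (integral_congr_ae (Filter.Eventually.of_forall fun x => ?_))
    simp only
    ring
  have hii : IntegrableOn (fun x => κ * (φ x - φ' x)) {x | φ' x < φ x} μ :=
    ((hi'.sub hi).congr (Filter.Eventually.of_forall fun x => by
      simp only [Pi.sub_apply]; ring)).integrableOn
  have hnn : 0 ≤ᵐ[μ.restrict {x | φ' x < φ x}] fun x => κ * (φ x - φ' x) := by
    filter_upwards [ae_restrict_mem hA] with x hx
    exact mul_nonneg hκ.le (sub_nonneg.2 (le_of_lt hx))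
  have hz := (integral_eq_zero_iff_of_nonneg_ae hnn hii).1
    (le_antisymm hle2 (integral_nonneg_of_ae hnn))
  filter_upwards [(ae_restrict_iff' hA).1 hz] with x hx
  by_contra hlt
  have hlt : φ' x < φ x := not_le.1 hlt
  have := hx hlt
  have h0 := mul_pos hκ (sub_pos.2 hlt)
  simp only [Pi.zero_apply] at this
  linarith

/-- The optimality equations have at most one solution. -/
theorem ae_eq_of_marginal_eq [IsFiniteMeasure μ] [NeZero μ] [IsFiniteMeasure σ]
    (hK : IsGibbsLike σ K) (hε : 0 < ε) {κ : ℝ} (hκ : 0 < κ)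
    (hφ : Measurable φ) (hφ0 : ∀ x, φ x ≤ 0) (hφ' : Measurable φ') (hφ'0 : ∀ x, φ' x ≤ 0)
    (h : ∀ᵐ x ∂μ, Real.exp (φ x / ε) * normalisedKernel μ σ K ε φ x = -κ * φ x)
    (h' : ∀ᵐ x ∂μ, Real.exp (φ' x / ε) * normalisedKernel μ σ K ε φ' x = -κ * φ' x) :
    φ =ᵐ[μ] φ' := by
  filter_upwards [ae_le_of_marginal_eq hK hε hκ hφ hφ0 hφ' hφ'0 h h',
    ae_le_of_marginal_eq hK hε hκ hφ' hφ'0 hφ hφ0 h' h] with x h1 h2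
  exact le_antisymm h1 h2

end AbstractKernel

/-! ### The reduced dual: upper bound, strong concavity, Lipschitz estimate -/

section ReducedDual

variable {α β : Type*} [MeasurableSpace α] [MeasurableSpace β]

/-- The dual objective after maximisation in the second potential, up to an additive constant. -/
def reducedDual (μ : Measure α) (σ : Measure β) (K : α → β → ℝ) (ε κ : ℝ) (φ : α → ℝ) : ℝ :=
  -ε * (∫ y, Real.log (gibbsMass μ K ε φ y) ∂σ) - κ / 2 * ∫ x, φ x ^ 2 ∂μ

/-- The nonpositive measurable square integrable functions. -/
structure IsNonposL2 (μ : Measure α) (φ : α → ℝ) : Prop where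
  measurable : Measurable φ
  nonpos : ∀ x, φ x ≤ 0
  memLp : MemLp φ 2 μ

variable {μ : Measure α} {σ : Measure β} {K : α → β → ℝ} {ε κ : ℝ} {φ φ' : α → ℝ}

theorem IsNonposL2.integrable [IsFiniteMeasure μ] (h : IsNonposL2 μ φ) : Integrable φ μ :=
  h.memLp.integrable (by norm_num)

theorem IsNonposL2.midpoint (h : IsNonposL2 μ φ) (h' : IsNonposL2 μ φ') :
    IsNonposL2 μ fun x => (φ x + φ' x) / 2 where
  measurable := (h.measurable.add h'.measurable).div_const 2
  nonpos x := by linarith [h.nonpos x, h'.nonpos x]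
  memLp := by
    have := (h.memLp.add h'.memLp).const_mul (1 / 2)
    refine this.ae_eq (Filter.Eventually.of_forall fun x => ?_)
    simp only [Pi.add_apply]
    ring

/-- Jensen's inequality for the exponential, by integrating its tangent at the mean `c` of `u`. -/
theorem mul_exp_average_le_integral_exp [IsFiniteMeasure μ] [NeZero μ] {u : α → ℝ}
    (hu : Integrable u μ) (hu' : Integrable (fun x => Real.exp (u x)) μ) :
    μ.real Set.univ * Real.exp ((∫ x, u x ∂μ) / μ.real Set.univ) ≤ ∫ x, Real.exp (u x) ∂μ := by
  have hm : 0 < μ.real Set.univ := measureReal_univ_pos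
  set c := (∫ x, u x ∂μ) / μ.real Set.univ with hc
  have h1 : Integrable (fun x => u x + (1 - c)) μ := hu.add (integrable_const _)
  have h2 : ∫ x, Real.exp c * (u x + (1 - c)) ∂μ ≤ ∫ x, Real.exp (u x) ∂μ := by
    refine integral_mono (h1.const_mul _) hu' fun x => ?_
    have h3 := mul_le_mul_of_nonneg_left (Real.add_one_le_exp (u x - c)) (Real.exp_pos c).le
    rw [← Real.exp_add] at h3
    simp only
    calc _ = Real.exp c * (u x - c + 1) := by ring
      _ ≤ _ := h3
      _ = _ := by congr 1; ring
  rw [integral_const_mul, integral_add hu (integrable_const _), integral_const] at h2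
  have h4 : ∫ x, u x ∂μ = c * μ.real Set.univ := by rw [hc]; field_simp
  rw [h4, smul_eq_mul] at h2
  refine le_trans (le_of_eq ?_) h2
  ring

/-- Cauchy–Schwarz against the constant one: the variance of `|u|` is nonnegative. -/
theorem sq_integral_abs_le [IsFiniteMeasure μ] [NeZero μ] {u : α → ℝ} (hu : MemLp u 2 μ) :
    (∫ x, |u x| ∂μ) ^ 2 ≤ μ.real Set.univ * ∫ x, u x ^ 2 ∂μ := by
  have hm : 0 < μ.real Set.univ := measureReal_univ_pos
  have h1 : Integrable (fun x => |u x|) μ := (hu.integrable (by norm_num)).abs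
  set s := ∫ x, |u x| ∂μ
  have h2 : 0 ≤ ∫ x, (u x ^ 2 - (2 * (s / μ.real Set.univ) * |u x|
      - (s / μ.real Set.univ) ^ 2)) ∂μ := by
    refine integral_nonneg fun x => ?_
    have := sq_nonneg (|u x| - s / μ.real Set.univ)
    rw [sub_sq, sq_abs] at this
    simp only [Pi.zero_apply]
    linarith
  have h1' : Integrable (fun x => 2 * (s / μ.real Set.univ) * |u x|
      - (s / μ.real Set.univ) ^ 2) μ := (h1.const_mul _).sub (integrable_const _)
  rw [integral_sub hu.integrable_sq h1', integral_sub (h1.const_mul _) (integrable_const _), integral_const_mul, integral_const,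
    smul_eq_mul] at h2
  have h3 := mul_nonneg hm.le h2
  have h4 : μ.real Set.univ * (∫ x, u x ^ 2 ∂μ - (2 * (s / μ.real Set.univ) * s -
      μ.real Set.univ * (s / μ.real Set.univ) ^ 2)) =
      μ.real Set.univ * ∫ x, u x ^ 2 ∂μ - s ^ 2 := by
    field_simp
    ring
  linarith

theorem bddAbove_reducedDual [IsFiniteMeasure μ] [NeZero μ] [IsProbabilityMeasure σ]
    (hK : IsGibbsLike σ K) (hε : 0 < ε) (hκ : 0 < κ) :
    BddAbove (reducedDual μ σ K ε κ '' {φ | IsNonposL2 μ φ}) := by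
  obtain ⟨q, hqi, hq⟩ := hK.exists_lower
  have hm : 0 < μ.real Set.univ := measureReal_univ_pos
  -- Jensen and the lower bound on the kernel give `log Z_φ ≥ -q + log m + (∫ φ) / (ε m)`, with `m`
  -- the mass of `μ`. The last term of the bound is the integral of the maximum `1 / (2κm²)` of `s ↦
  -- -s/m - κ s²/2`.
  refine ⟨ε * (∫ y, q y ∂σ) - ε * Real.log (μ.real Set.univ) +
    μ.real Set.univ * (1 / (2 * κ * μ.real Set.univ ^ 2)), ?_⟩
  rintro _ ⟨φ, hφ, rfl⟩
  set m := μ.real Set.univ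
  have hφi := hφ.integrable
  have h1 : ∀ y, -q y + (Real.log m + (∫ x, φ x ∂μ) / ε / m) ≤
      Real.log (gibbsMass μ K ε φ y) := by
    intro y
    have h2 := mul_exp_average_le_integral_exp (hφi.div_const ε)
      (integrable_exp_div hε hφ.measurable hφ.nonpos)
    rw [integral_div] at h2
    have h3 := (mul_le_mul_of_nonneg_left h2 (Real.exp_pos (-q y)).le).trans
      (exp_neg_mul_le_gibbsMass hK hε hφ.measurable hφ.nonpos hq y)
    have h4 := Real.log_le_log (by positivity) h3
    rwa [Real.log_mul (by positivity) (by positivity), Real.log_mul (by positivity)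
      (by positivity), Real.log_exp, Real.log_exp] at h4
  have h5 := integral_mono (hqi.neg.add (integrable_const (Real.log m + (∫ x, φ x ∂μ) / ε / m)))
    (integrable_log_gibbsMass (μ := μ) hK hε hφ.measurable hφ.nonpos) h1
  rw [integral_add' hqi.neg (integrable_const _), integral_neg', integral_const,
    probReal_univ, one_smul] at h5
  have h6 : -(1 / m) * (∫ x, φ x ∂μ) - κ / 2 * ∫ x, φ x ^ 2 ∂μ ≤
      m * (1 / (2 * κ * m ^ 2)) := by
    rw [← integral_const_mul, ← integral_const_mul, ← integral_sub (hφi.const_mul _)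
      (hφ.memLp.integrable_sq.const_mul _)]
    calc _ ≤ ∫ _, 1 / (2 * κ * m ^ 2) ∂μ := by
          refine integral_mono ((hφi.const_mul _).sub (hφ.memLp.integrable_sq.const_mul _))
            (integrable_const _) fun x => ?_
          have h7 : 1 / (2 * κ * m ^ 2) - (-(1 / m) * φ x - κ / 2 * φ x ^ 2) =
              κ / 2 * (φ x + 1 / (κ * m)) ^ 2 := by
            field_simp
            ring
          have h8 : 0 ≤ κ / 2 * (φ x + 1 / (κ * m)) ^ 2 := by positivity
          simp only
          linarith
      _ = _ := by rw [integral_const, smul_eq_mul]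
  have h9 := mul_le_mul_of_nonneg_left h5 hε.le
  have h10 : ε * ((∫ x, φ x ∂μ) / ε / m) = 1 / m * ∫ x, φ x ∂μ := by field_simp
  rw [reducedDual]
  nlinarith

/-- Log-convexity of the mass in `φ`. After dividing by the masses `exp a` and `exp b`, it reduces
to `2st ≤ s² + t²` under the integral. -/
theorem log_gibbsMass_midpoint_le [IsFiniteMeasure μ] [NeZero μ]
    (hK : IsGibbsLike σ K) (hε : 0 < ε) (h : IsNonposL2 μ φ) (h' : IsNonposL2 μ φ') (y : β) :
    Real.log (gibbsMass μ K ε (fun x => (φ x + φ' x) / 2) y) ≤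
      (Real.log (gibbsMass μ K ε φ y) + Real.log (gibbsMass μ K ε φ' y)) / 2 := by
  have hm := h.midpoint h'
  have p := gibbsMass_pos (μ := μ) hK hε h.measurable h.nonpos y
  have p' := gibbsMass_pos (μ := μ) hK hε h'.measurable h'.nonpos y
  have pm := gibbsMass_pos (μ := μ) hK hε hm.measurable hm.nonpos y
  have i := integrable_exp_mul_kernel (μ := μ) hK hε h.measurable h.nonpos y
  have i' := integrable_exp_mul_kernel (μ := μ) hK hε h'.measurable h'.nonpos y
  have im := integrable_exp_mul_kernel (μ := μ) hK hε hm.measurable hm.nonpos y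
  set a := Real.log (gibbsMass μ K ε φ y) with ha
  set b := Real.log (gibbsMass μ K ε φ' y) with hb
  have key : Real.exp (-((a + b) / 2)) * gibbsMass μ K ε (fun x => (φ x + φ' x) / 2) y ≤
      Real.exp (-a) / 2 * gibbsMass μ K ε φ y + Real.exp (-b) / 2 * gibbsMass μ K ε φ' y := by
    simp only [gibbsMass]
    rw [← integral_const_mul, ← integral_const_mul, ← integral_const_mul,
      ← integral_add (i.const_mul _) (i'.const_mul _)]
    refine integral_mono (im.const_mul _) ((i.const_mul _).add (i'.const_mul _)) fun x => ?_
    have h1 : Real.exp (-((a + b) / 2)) * Real.exp ((φ x + φ' x) / 2 / ε) ≤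
        Real.exp (-a) / 2 * Real.exp (φ x / ε) + Real.exp (-b) / 2 * Real.exp (φ' x / ε) := by
      set s := Real.exp ((φ x / ε - a) / 2) with hs
      set t := Real.exp ((φ' x / ε - b) / 2) with ht
      have e1 : Real.exp (-((a + b) / 2)) * Real.exp ((φ x + φ' x) / 2 / ε) = s * t := by
        rw [hs, ht, ← Real.exp_add, ← Real.exp_add]
        congr 1
        ring
      have e2 : Real.exp (-a) * Real.exp (φ x / ε) = s ^ 2 := by
        rw [hs, ← Real.exp_add, sq, ← Real.exp_add]
        congr 1
        ring
      have e3 : Real.exp (-b) * Real.exp (φ' x / ε) = t ^ 2 := by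
        rw [ht, ← Real.exp_add, sq, ← Real.exp_add]
        congr 1
        ring
      nlinarith [sq_nonneg (s - t)]
    have h2 := mul_le_mul_of_nonneg_right h1 (hK.pos x y).le
    simp only
    linarith
  have ea : Real.exp (-a) * gibbsMass μ K ε φ y = 1 := by
    rw [Real.exp_neg, ha, Real.exp_log p, inv_mul_cancel₀ p.ne']
  have eb : Real.exp (-b) * gibbsMass μ K ε φ' y = 1 := by
    rw [Real.exp_neg, hb, Real.exp_log p', inv_mul_cancel₀ p'.ne']
  have key2 : Real.exp (-((a + b) / 2)) * gibbsMass μ K ε (fun x => (φ x + φ' x) / 2) y ≤ 1 := by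
    linarith
  have := Real.log_le_log (by positivity) key2
  rw [Real.log_mul (by positivity) pm.ne', Real.log_exp, Real.log_one] at this
  linarith

/-- The entropy term is concave by the log-convexity of the mass; the parallelogram identity for the
square term produces the gain `κ/8`. -/
theorem reducedDual_midpoint [IsFiniteMeasure μ] [NeZero μ] [IsFiniteMeasure σ]
    (hK : IsGibbsLike σ K) (hε : 0 < ε) (h : IsNonposL2 μ φ) (h' : IsNonposL2 μ φ') :
    (reducedDual μ σ K ε κ φ + reducedDual μ σ K ε κ φ') / 2
        + κ / 8 * ∫ x, (φ x - φ' x) ^ 2 ∂μ ≤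
      reducedDual μ σ K ε κ fun x => (φ x + φ' x) / 2 := by
  have hm := h.midpoint h'
  have i := integrable_log_gibbsMass (μ := μ) (σ := σ) hK hε h.measurable h.nonpos
  have i' := integrable_log_gibbsMass (μ := μ) (σ := σ) hK hε h'.measurable h'.nonpos
  have im := integrable_log_gibbsMass (μ := μ) (σ := σ) hK hε hm.measurable hm.nonpos
  have h1 := integral_mono im ((i.add i').div_const 2)
    (log_gibbsMass_midpoint_le (μ := μ) hK hε h h')
  simp only [Pi.add_apply] at h1
  rw [integral_div, integral_add i i'] at h1
  have h2 : ∫ x, ((φ x + φ' x) / 2) ^ 2 ∂μ = (∫ x, φ x ^ 2 ∂μ) / 2 + (∫ x, φ' x ^ 2 ∂μ) / 2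
      - (∫ x, (φ x - φ' x) ^ 2 ∂μ) / 4 := by
    have j := h.memLp.integrable_sq
    have j' := h'.memLp.integrable_sq
    have jd : Integrable (fun x => (φ x - φ' x) ^ 2) μ := (h.memLp.sub h'.memLp).integrable_sq
    have js : Integrable (fun x => φ x ^ 2 / 2 + φ' x ^ 2 / 2) μ :=
      (j.div_const _).add (j'.div_const _)
    rw [← integral_div, ← integral_div, ← integral_div,
      ← integral_add (j.div_const _) (j'.div_const _), ← integral_sub js (jd.div_const _)]
    congr 1 with x
    ring
  have h3 := mul_le_mul_of_nonneg_left h1 hε.le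
  simp only [reducedDual]
  rw [h2]
  linarith

/-- On nonpositive arguments `s ↦ exp (s / ε)` is Lipschitz with constant `ε⁻¹`, and `k` takes
values in `[0, 1]`. -/
theorem abs_integral_exp_mul_sub_le [IsFiniteMeasure μ] (hε : 0 < ε)
    (h : IsNonposL2 μ φ) (h' : IsNonposL2 μ φ') {k : α → ℝ} (hk : Measurable k)
    (hk0 : ∀ x, 0 ≤ k x) (hk1 : ∀ x, k x ≤ 1) :
    |∫ x, Real.exp (φ x / ε) * k x ∂μ - ∫ x, Real.exp (φ' x / ε) * k x ∂μ| ≤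
      ε⁻¹ * ∫ x, |φ x - φ' x| ∂μ := by
  have hi : ∀ ρ : α → ℝ, IsNonposL2 μ ρ → Integrable (fun x => Real.exp (ρ x / ε) * k x) μ := by
    intro ρ hρ
    refine (integrable_exp_div hε hρ.measurable hρ.nonpos).mul_bdd hk.aestronglyMeasurable
      (c := 1) (Filter.Eventually.of_forall fun x => ?_)
    rw [Real.norm_of_nonneg (hk0 x)]
    exact hk1 x
  have hexp : ∀ s t : ℝ, s ≤ 0 → Real.exp (s / ε) - Real.exp (t / ε) ≤ ε⁻¹ * |s - t| := by
    intro s t hs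
    have h1 : Real.exp (s / ε) * (t / ε - s / ε + 1) ≤ Real.exp (t / ε) := by
      have := mul_le_mul_of_nonneg_left (Real.add_one_le_exp (t / ε - s / ε))
        (Real.exp_pos (s / ε)).le
      rwa [← Real.exp_add, add_sub_cancel] at this
    have h2 : Real.exp (s / ε) * (s / ε - t / ε) ≤ 1 * |s / ε - t / ε| :=
      (mul_le_mul_of_nonneg_left (le_abs_self _) (Real.exp_pos _).le).trans
        (mul_le_mul_of_nonneg_right (exp_div_le_one hε hs) (abs_nonneg _))
    have h3 : |s / ε - t / ε| = ε⁻¹ * |s - t| := by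
      rw [← sub_div, abs_div, abs_of_pos hε, inv_mul_eq_div]
    linarith
  rw [← integral_sub (hi φ h) (hi φ' h'), ← integral_const_mul]
  refine abs_integral_le_integral_abs.trans (integral_mono ((hi φ h).sub (hi φ' h')).abs
    ((h.integrable.sub h'.integrable).abs.const_mul _) fun x => ?_)
  simp only
  rw [← sub_mul, abs_mul, abs_of_nonneg (hk0 x)]
  refine (mul_le_of_le_one_right (abs_nonneg _) (hk1 x)).trans (abs_sub_le_iff.2 ⟨?_, ?_⟩)
  · exact hexp _ _ (h.nonpos x)
  · rw [abs_sub_comm]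
    exact hexp _ _ (h'.nonpos x)

end ReducedDual

/-! ### Existence of a maximiser of the reduced dual and its optimality equation -/

section ReducedDualMaximiser

open Filter Topology

variable {α β : Type*} [MeasurableSpace α] [MeasurableSpace β]
  {μ : Measure α} {σ : Measure β} {K : α → β → ℝ} {ε κ : ℝ} {φ φ' : α → ℝ}

theorem norm_toLp_sq {u : α → ℝ} (hu : MemLp u 2 μ) : ‖hu.toLp u‖ ^ 2 = ∫ x, u x ^ 2 ∂μ := by
  rw [← real_inner_self_eq_norm_sq, L2.inner_def]
  refine integral_congr_ae ?_
  filter_upwards [hu.coeFn_toLp] with x hx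
  rw [hx]
  simp [sq]

theorem dist_toLp_sq {u v : α → ℝ} (hu : MemLp u 2 μ) (hv : MemLp v 2 μ) :
    dist (hu.toLp u) (hv.toLp v) ^ 2 = ∫ x, (u x - v x) ^ 2 ∂μ := by
  rw [dist_eq_norm, ← MemLp.toLp_sub hu hv, norm_toLp_sq]
  rfl

theorem tendsto_integral_exp_mul [IsFiniteMeasure μ] (hε : 0 < ε) {u : ℕ → α → ℝ}
    (hu : ∀ n, IsNonposL2 μ (u n)) (hφ : IsNonposL2 μ φ)
    (hL : Tendsto (fun n => ∫ x, |u n x - φ x| ∂μ) atTop (𝓝 0)) {k : α → ℝ} (hk : Measurable k)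
    (hk0 : ∀ x, 0 ≤ k x) (hk1 : ∀ x, k x ≤ 1) :
    Tendsto (fun n => ∫ x, Real.exp (u n x / ε) * k x ∂μ) atTop
      (𝓝 (∫ x, Real.exp (φ x / ε) * k x ∂μ)) := by
  rw [tendsto_iff_dist_tendsto_zero]
  refine squeeze_zero (fun n => dist_nonneg) (fun n => ?_)
    (by simpa using hL.const_mul ε⁻¹)
  exact abs_integral_exp_mul_sub_le hε (hu n) hφ hk hk0 hk1

theorem tendsto_reducedDual [IsFiniteMeasure μ] [NeZero μ] [IsFiniteMeasure σ]
    (hK : IsGibbsLike σ K) (hε : 0 < ε) {u : ℕ → α → ℝ}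
    (hu : ∀ n, IsNonposL2 μ (u n)) (hφ : IsNonposL2 μ φ)
    (hL : Tendsto (fun n => (hu n).memLp.toLp (u n)) atTop (𝓝 (hφ.memLp.toLp φ))) :
    Tendsto (fun n => reducedDual μ σ K ε κ (u n)) atTop (𝓝 (reducedDual μ σ K ε κ φ)) := by
  obtain ⟨q, hqi, hq⟩ := hK.exists_lower
  have hsq : Tendsto (fun n => ∫ x, u n x ^ 2 ∂μ) atTop (𝓝 (∫ x, φ x ^ 2 ∂μ)) := by
    simp only [← norm_toLp_sq hφ.memLp, ← norm_toLp_sq (hu _).memLp]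
    exact hL.norm.pow 2
  have hL1 : Tendsto (fun n => ∫ x, |u n x - φ x| ∂μ) atTop (𝓝 0) := by
    have h1 : Tendsto (fun n => √(μ.real Set.univ *
        dist ((hu n).memLp.toLp (u n)) (hφ.memLp.toLp φ) ^ 2)) atTop (𝓝 0) := by
      have h2 := tendsto_iff_dist_tendsto_zero.1 hL
      simpa using (((h2.pow 2).const_mul (μ.real Set.univ))).sqrt
    refine squeeze_zero (fun n => integral_nonneg fun x => abs_nonneg _) (fun n => ?_) h1
    refine Real.le_sqrt_of_sq_le ?_
    rw [dist_toLp_sq]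
    exact sq_integral_abs_le ((hu n).memLp.sub hφ.memLp)
  have hc := integral_exp_div_pos (μ := μ) hε hφ.measurable hφ.nonpos
  set c := ∫ x, Real.exp (φ x / ε) ∂μ
  -- Keeps the masses away from zero along the sequence, so that one integrable function of `y`
  -- dominates all the logarithms.
  have hcn : ∀ᶠ n in atTop, c / 2 ≤ ∫ x, Real.exp (u n x / ε) ∂μ := by
    have := tendsto_integral_exp_mul hε hu hφ hL1 (k := fun _ => 1) measurable_const
      (fun _ => zero_le_one) (fun _ => le_rfl)
    simp only [mul_one] at this
    exact this.eventually_const_le (half_lt_self hc)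
  have hlog : Tendsto (fun n => ∫ y, Real.log (gibbsMass μ K ε (u n) y) ∂σ) atTop
      (𝓝 (∫ y, Real.log (gibbsMass μ K ε φ y) ∂σ)) := by
    refine tendsto_integral_filter_of_dominated_convergence
      (fun y => |q y| + (|Real.log (c / 2)| + |Real.log (μ.real Set.univ)|)) ?_ ?_ ?_ ?_
    · exact Eventually.of_forall fun n => (integrable_log_gibbsMass hK hε (hu n).measurable
        (hu n).nonpos).aestronglyMeasurable
    · filter_upwards [hcn] with n hn
      exact Eventually.of_forall fun y => abs_log_gibbsMass_le hK hε (hu n).measurable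
        (hu n).nonpos hq (half_pos hc) hn y
    · exact hqi.abs.add (integrable_const _)
    · refine Eventually.of_forall fun y => ?_
      exact (tendsto_integral_exp_mul hε hu hφ hL1 (hK.measurable_left y)
        (fun x => (hK.pos x y).le) (fun x => hK.le_one x y)).log
        (gibbsMass_pos hK hε hφ.measurable hφ.nonpos y).ne'
  exact (hlog.const_mul (-ε)).sub (hsq.const_mul (κ / 2))

theorem exists_isMax_reducedDual [IsFiniteMeasure μ] [NeZero μ] [IsProbabilityMeasure σ]
    (hK : IsGibbsLike σ K) (hε : 0 < ε) (hκ : 0 < κ) :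
    ∃ φ, IsNonposL2 μ φ ∧
      ∀ ρ, IsNonposL2 μ ρ → reducedDual μ σ K ε κ ρ ≤ reducedDual μ σ K ε κ φ := by
  have hbdd := bddAbove_reducedDual (μ := μ) hK hε hκ
  set S := reducedDual μ σ K ε κ '' {φ | IsNonposL2 μ φ}
  have hne : S.Nonempty :=
    ⟨_, 0, ⟨measurable_zero, fun _ => le_rfl, MemLp.zero⟩, rfl⟩
  obtain ⟨v, hvm, hvt, hvS⟩ := exists_seq_tendsto_sSup hne hbdd
  choose u hu huv using hvS
  have hu : ∀ n, IsNonposL2 μ (u n) := hu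
  have hcauchy : CauchySeq fun n => (hu n).memLp.toLp (u n) := by
    -- The radius comes from strong concavity: the value at the midpoint is at most `sSup S`, and
    -- `v` is monotone, so `v n` and `v m` are at least `v N`.
    refine cauchySeq_of_le_tendsto_0 (fun N => √(8 / κ * (sSup S - v N))) (fun n m N hn hm => ?_) ?_
    · refine Real.le_sqrt_of_sq_le ?_
      rw [dist_toLp_sq]
      have h1 := reducedDual_midpoint (κ := κ) hK hε (hu n) (hu m)
      have h2 := le_csSup hbdd ⟨_, (hu n).midpoint (hu m), rfl⟩
      rw [huv, huv] at h1
      have h3 : κ / 8 * ∫ x, (u n x - u m x) ^ 2 ∂μ ≤ sSup S - v N := by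
        linarith [hvm hn, hvm hm]
      have h4 := mul_le_mul_of_nonneg_left h3 (by positivity : 0 ≤ 8 / κ)
      refine le_trans (le_of_eq ?_) h4
      field_simp
    · simpa using (((tendsto_const_nhds (x := sSup S)).sub hvt).const_mul (8 / κ)).sqrt
  obtain ⟨F, hF⟩ := cauchySeq_tendsto_of_complete hcauchy
  -- Membership requires nonpositivity at every point, so the limit is truncated at zero. As each `u
  -- n` is nonpositive, truncation does not increase the distance to it, and the limit is unchanged.
  have hφ : IsNonposL2 μ fun x => min (F x) 0 := by
    refine ⟨(Lp.stronglyMeasurable F).measurable.min measurable_const, fun x => min_le_right _ _,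
      ?_⟩
    refine (Lp.memLp F).mono
      ((Lp.stronglyMeasurable F).measurable.min measurable_const).aestronglyMeasurable
      (Eventually.of_forall fun x => ?_)
    rw [Real.norm_eq_abs, Real.norm_eq_abs]
    rcases le_total (F x) 0 with h | h
    · rw [min_eq_left h]
    · rw [min_eq_right h, abs_zero]
      exact abs_nonneg _
  have hlim : Tendsto (fun n => (hu n).memLp.toLp (u n)) atTop (𝓝 (hφ.memLp.toLp _)) := by
    rw [tendsto_iff_dist_tendsto_zero] at hF ⊢
    refine squeeze_zero (fun n => dist_nonneg) (fun n => ?_) hF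
    refine abs_le_of_sq_le_sq' ?_ dist_nonneg |>.2
    conv_rhs => rw [← Lp.toLp_coeFn F (Lp.memLp F)]
    rw [dist_toLp_sq, dist_toLp_sq]
    refine integral_mono ((hu n).memLp.sub hφ.memLp).integrable_sq
      ((hu n).memLp.sub (Lp.memLp F)).integrable_sq fun x => ?_
    simp only
    rcases le_total (F x) 0 with h | h
    · rw [min_eq_left h]
    · rw [min_eq_right h]
      have := (hu n).nonpos x
      nlinarith
  refine ⟨_, hφ, fun ρ hρ => ?_⟩
  have h1 := tendsto_reducedDual (κ := κ) hK hε hu hφ hlim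
  simp only [huv] at h1
  rw [tendsto_nhds_unique h1 hvt]
  exact le_csSup hbdd ⟨ρ, hρ, rfl⟩

/-- A maximiser of the reduced dual satisfies the pointwise optimality equation. -/
theorem ae_eq_of_isMax_reducedDual [IsFiniteMeasure μ] [NeZero μ] [IsProbabilityMeasure σ]
    (hK : IsGibbsLike σ K) (hε : 0 < ε) (hκ : 0 < κ) (hφ : IsNonposL2 μ φ)
    (hmax : ∀ ρ, IsNonposL2 μ ρ → reducedDual μ σ K ε κ ρ ≤ reducedDual μ σ K ε κ φ)
    {ρ : α → ℝ} (hρ : Measurable ρ) (hρ0 : ∀ x, ρ x ≤ 0)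
    (hρeq : ∀ x, Real.exp (ρ x / ε) * normalisedKernel μ σ K ε φ x = -κ * ρ x) :
    φ =ᵐ[μ] ρ := by
  set G := normalisedKernel μ σ K ε φ with hG
  have hG0 : ∀ x, 0 ≤ G x := normalisedKernel_nonneg hK hε hφ.measurable hφ.nonpos
  have hφG := integrable_exp_mul_normalisedKernel (μ := μ) hK hε hφ.measurable hφ.nonpos
  have hφ1 : ∫ x, Real.exp (φ x / ε) * G x ∂μ = 1 := by
    have := setIntegral_exp_mul_normalisedKernel (μ := μ) hK hε hφ.measurable hφ.nonpos Set.univ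
    rw [setIntegral_univ] at this
    rw [this]
    simp only [setIntegral_univ]
    have h1 : ∀ y, (∫ x, Real.exp (φ x / ε) * K x y ∂μ) / gibbsMass μ K ε φ y = 1 := fun y =>
      div_self (gibbsMass_pos hK hε hφ.measurable hφ.nonpos y).ne'
    simp [h1]
  -- For each `x`, `s ↦ ε exp(s/ε) G(x) + κ s²/2` is strongly convex with modulus `κ`, and `hρeq`
  -- says that `ρ x` is its critical point.
  have hpt : ∀ x, κ / 2 * (φ x - ρ x) ^ 2 + ε * (Real.exp (ρ x / ε) * G x) + κ / 2 * ρ x ^ 2 ≤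
      ε * (Real.exp (φ x / ε) * G x) + κ / 2 * φ x ^ 2 := by
    intro x
    have h1 := mul_le_mul_of_nonneg_left (Real.add_one_le_exp (φ x / ε - ρ x / ε))
      (Real.exp_pos (ρ x / ε)).le
    rw [← Real.exp_add, add_sub_cancel] at h1
    have h2 := mul_le_mul_of_nonneg_right h1 (mul_nonneg hε.le (hG0 x))
    have h3 : Real.exp (ρ x / ε) * (φ x / ε - ρ x / ε + 1) * (ε * G x) =
        Real.exp (ρ x / ε) * G x * (φ x - ρ x + ε) := by field_simp
    rw [h3] at h2
    have h4 := hρeq x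
    rw [h4] at h2 ⊢
    nlinarith
  -- `ρ` is not assumed square integrable; `hpt` bounds `κ ρ²/2` by the integrable function on its
  -- right-hand side.
  have hρ2 : IsNonposL2 μ ρ := by
    refine ⟨hρ, hρ0, (memLp_two_iff_integrable_sq hρ.aestronglyMeasurable).2 ?_⟩
    refine Integrable.mono' ((hφG.const_mul (2 * ε / κ)).add hφ.memLp.integrable_sq)
      (hρ.pow_const 2).aestronglyMeasurable (Eventually.of_forall fun x => ?_)
    rw [Real.norm_of_nonneg (sq_nonneg _)]
    simp only [Pi.add_apply]
    have h1 := hpt x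
    have h2 : 0 ≤ κ / 2 * (φ x - ρ x) ^ 2 := by positivity
    have h3 : 0 ≤ ε * (Real.exp (ρ x / ε) * G x) :=
      mul_nonneg hε.le (mul_nonneg (Real.exp_pos _).le (hG0 x))
    have h4 : κ / 2 * ρ x ^ 2 ≤ ε * (Real.exp (φ x / ε) * G x) + κ / 2 * φ x ^ 2 := by linarith
    have h5 := mul_le_mul_of_nonneg_left h4 (by positivity : 0 ≤ 2 / κ)
    calc ρ x ^ 2 = 2 / κ * (κ / 2 * ρ x ^ 2) := by field_simp
      _ ≤ _ := h5
      _ = _ := by field_simp; rfl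
  have hρG : Integrable (fun x => Real.exp (ρ x / ε) * G x) μ := by
    simp only [hρeq]
    exact hρ2.integrable.const_mul _
  have hprod : Integrable (fun p : α × β =>
      Real.exp (ρ p.1 / ε) * ((gibbsMass μ K ε φ p.2)⁻¹ * K p.1 p.2)) (μ.prod σ) := by
    refine (integrable_prod_iff
      (measurable_normalised_prod hK hφ.measurable hρ).aestronglyMeasurable).2 ⟨?_, ?_⟩
    · filter_upwards [ae_integrable_normalisedKernel (μ := μ) hK hε hφ.measurable hφ.nonpos]
        with x hx
      exact hx.const_mul _
    · refine hρG.congr (Eventually.of_forall fun x => ?_)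
      simp only
      rw [hG, normalisedKernel, ← integral_const_mul]
      congr 1 with y
      have := (gibbsMass_pos (μ := μ) hK hε hφ.measurable hφ.nonpos y).le
      have := (hK.pos x y).le
      rw [Real.norm_of_nonneg (by positivity)]
  have hratio : Integrable (fun y => gibbsMass μ K ε ρ y / gibbsMass μ K ε φ y) σ ∧
      ∫ y, gibbsMass μ K ε ρ y / gibbsMass μ K ε φ y ∂σ =
        ∫ x, Real.exp (ρ x / ε) * G x ∂μ := by
    have h1 : ∀ y, ∫ x, Real.exp (ρ x / ε) * ((gibbsMass μ K ε φ y)⁻¹ * K x y) ∂μ =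
        gibbsMass μ K ε ρ y / gibbsMass μ K ε φ y := by
      intro y
      have := integral_normalised_eq_div (μ := μ) (K := K) (ε := ε) (φ := φ) (φ' := ρ) y Set.univ
      rwa [setIntegral_univ, setIntegral_univ] at this
    have h2 := hprod.integral_prod_right
    have h3 := integral_integral_swap (f := fun x y =>
      Real.exp (ρ x / ε) * ((gibbsMass μ K ε φ y)⁻¹ * K x y)) hprod
    simp only [h1] at h2 h3
    refine ⟨h2, h3.symm.trans ?_⟩
    simp only [integral_const_mul]
    rfl
  -- `log t ≤ t - 1` at `t = Z_ρ / Z_φ`: the logarithm is linearised at `φ`, and the linear term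
  -- involves `ρ` only through the frozen `G`.
  have hlogle : ∫ y, Real.log (gibbsMass μ K ε ρ y) ∂σ - ∫ y, Real.log (gibbsMass μ K ε φ y) ∂σ ≤
      ∫ x, Real.exp (ρ x / ε) * G x ∂μ - 1 := by
    have iρ := integrable_log_gibbsMass (μ := μ) (σ := σ) hK hε hρ hρ0
    have iφ := integrable_log_gibbsMass (μ := μ) (σ := σ) hK hε hφ.measurable hφ.nonpos
    rw [← integral_sub iρ iφ, ← hratio.2]
    have h1 : (1 : ℝ) = ∫ _, 1 ∂σ := by simp
    conv_rhs => rw [h1]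
    rw [← integral_sub hratio.1 (integrable_const _)]
    refine integral_mono (iρ.sub iφ) (hratio.1.sub (integrable_const _)) fun y => ?_
    have pρ := gibbsMass_pos (μ := μ) hK hε hρ hρ0 y
    have pφ := gibbsMass_pos (μ := μ) hK hε hφ.measurable hφ.nonpos y
    simp only
    rw [← Real.log_div pρ.ne' pφ.ne']
    exact Real.log_le_sub_one_of_pos (div_pos pρ pφ)
  have hd2 : Integrable (fun x => (φ x - ρ x) ^ 2) μ := (hφ.memLp.sub hρ2.memLp).integrable_sq
  have hint : κ / 2 * (∫ x, (φ x - ρ x) ^ 2 ∂μ) + ε * (∫ x, Real.exp (ρ x / ε) * G x ∂μ) +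
      κ / 2 * (∫ x, ρ x ^ 2 ∂μ) ≤
      ε * (∫ x, Real.exp (φ x / ε) * G x ∂μ) + κ / 2 * ∫ x, φ x ^ 2 ∂μ := by
    have i1 : Integrable (fun x => κ / 2 * (φ x - ρ x) ^ 2) μ := hd2.const_mul _
    have i2 : Integrable (fun x => ε * (Real.exp (ρ x / ε) * G x)) μ := hρG.const_mul _
    have i3 : Integrable (fun x => κ / 2 * ρ x ^ 2) μ := hρ2.memLp.integrable_sq.const_mul _
    have i4 : Integrable (fun x => ε * (Real.exp (φ x / ε) * G x)) μ := hφG.const_mul _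
    have i5 : Integrable (fun x => κ / 2 * φ x ^ 2) μ := hφ.memLp.integrable_sq.const_mul _
    have := integral_mono ((i1.add i2).add i3) (i4.add i5) hpt
    simp only [Pi.add_apply] at this
    have i12 : Integrable (fun x => κ / 2 * (φ x - ρ x) ^ 2 + ε * (Real.exp (ρ x / ε) * G x)) μ :=
      i1.add i2
    rw [integral_add i12 i3, integral_add i4 i5, integral_add i1 i2] at this
    simpa only [integral_const_mul] using this
  have hJ := hmax ρ hρ2
  simp only [reducedDual] at hJ
  rw [hφ1] at hint
  have h1 := mul_le_mul_of_nonneg_left hlogle hε.le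
  have h2 : κ / 2 * (∫ x, (φ x - ρ x) ^ 2 ∂μ) ≤ 0 := by linarith
  have h3 : ∫ x, (φ x - ρ x) ^ 2 ∂μ = 0 :=
    le_antisymm (nonpos_of_mul_nonpos_right h2 (by positivity))
      (integral_nonneg fun x => sq_nonneg _)
  exact ae_eq_of_integral_sub_sq_eq_zero hφ.memLp hρ2.memLp h3

end ReducedDualMaximiser

/-! ### Lipschitz continuity of the Lambert function and the marginal form of its equation -/

section Lambert

theorem lambertW0_nonneg {z : ℝ} (hz : 0 ≤ z) : 0 ≤ lambertW0 z := by
  obtain ⟨-, h⟩ := lambertW0_spec hz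
  by_contra hneg
  have := mul_neg_of_neg_of_pos (not_le.1 hneg) (Real.exp_pos (lambertW0 z))
  linarith

/-- `w ↦ w * exp w` does not contract distances on `[0, ∞)`; hence its inverse there is 1-Lipschitz.
-/
theorem sub_le_mul_exp_sub_mul_exp {a b : ℝ} (ha : 0 ≤ a) (hab : a ≤ b) :
    b - a ≤ b * Real.exp b - a * Real.exp a := by
  have h1 := mul_le_mul_of_nonneg_left (Real.exp_le_exp.2 hab) ha
  have h2 := mul_le_mul_of_nonneg_left (Real.one_le_exp (ha.trans hab)) (sub_nonneg.2 hab)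
  nlinarith

theorem abs_lambertW0_sub_le {x y : ℝ} (hx : 0 ≤ x) (hy : 0 ≤ y) :
    |lambertW0 x - lambertW0 y| ≤ |x - y| := by
  wlog h : lambertW0 y ≤ lambertW0 x generalizing x y
  · rw [abs_sub_comm, abs_sub_comm x]
    exact this hy hx (le_of_not_ge h)
  have h1 := sub_le_mul_exp_sub_mul_exp (lambertW0_nonneg hy) h
  rw [(lambertW0_spec hx).2, (lambertW0_spec hy).2] at h1
  rw [abs_of_nonneg (sub_nonneg.2 h)]
  exact h1.trans (le_abs_self _)

theorem continuousOn_lambertW0 : ContinuousOn lambertW0 (Set.Ici 0) := by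
  refine LipschitzOnWith.continuousOn (K := 1) (LipschitzOnWith.of_dist_le_mul fun x hx y hy => ?_)
  simpa [Real.dist_eq] using abs_lambertW0_sub_le hx hy

theorem exp_mul_eq_of_lambert {f g ε s G : ℝ} (hf : f ≠ 0) (hg : 0 < g) (hε : 0 < ε) (hG : 0 ≤ G)
    (hs : s = -ε * lambertW0 (g / (ε * f ^ 2) * G)) :
    Real.exp (s / ε) * G = -(f ^ 2 / g) * s := by
  have hf2 : 0 < f ^ 2 := by positivity
  obtain ⟨-, h⟩ := lambertW0_spec (z := g / (ε * f ^ 2) * G) (by positivity)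
  set w := lambertW0 (g / (ε * f ^ 2) * G)
  have hG' : G = ε * f ^ 2 / g * (w * Real.exp w) := by
    rw [h]
    field_simp
  have h1 : s / ε = -w := by
    rw [hs]
    field_simp
  rw [h1, hG', hs, Real.exp_neg]
  field_simp

end Lambert

/-! ### The Gibbs kernel and Lebesgue measure on `Ω` -/

section Kernel

variable {d : ℕ} {Ω : Set (EuclideanSpace ℝ (Fin d))}

theorem continuous_gibbsKernel (ε : ℝ) : Continuous fun p : EuclideanSpace ℝ (Fin d) ×
    EuclideanSpace ℝ (Fin d) => gibbsKernel ε p.1 p.2 := by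
  unfold gibbsKernel
  fun_prop

theorem gibbsKernel_pos (ε : ℝ) (X Y : EuclideanSpace ℝ (Fin d)) : 0 < gibbsKernel ε X Y :=
  Real.exp_pos _

theorem gibbsKernel_le_one {ε : ℝ} (hε : 0 < ε) (X Y : EuclideanSpace ℝ (Fin d)) :
    gibbsKernel ε X Y ≤ 1 :=
  Real.exp_le_one_iff.2 (neg_nonpos.2 (by positivity))

/-- The Gibbs kernel on `Ω × ℝᵈ`. -/
def kernelOn (Ω : Set (EuclideanSpace ℝ (Fin d))) (ε : ℝ) (X : Ω)
    (Y : EuclideanSpace ℝ (Fin d)) : ℝ :=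
  gibbsKernel ε X Y

theorem isGibbsLike_kernelOn {σ : Measure (EuclideanSpace ℝ (Fin d))} [IsFiniteMeasure σ]
    (hΩ : Bornology.IsBounded Ω) (hσ : Integrable (fun Y => ‖Y‖ ^ 2) σ) {ε : ℝ} (hε : 0 < ε) :
    IsGibbsLike σ (kernelOn Ω ε) where
  measurable := ((continuous_gibbsKernel ε).comp
    (continuous_subtype_val.prodMap continuous_id)).measurable
  pos _ _ := gibbsKernel_pos _ _ _
  le_one _ _ := gibbsKernel_le_one hε _ _
  exists_lower := by
    obtain ⟨R, hR⟩ := hΩ.exists_norm_le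
    -- From `‖X - Y‖² ≤ 2 (R² + ‖Y‖²)` for `X ∈ Ω`; the second moment of `σ` makes this function
    -- integrable.
    refine ⟨fun Y => (R ^ 2 + ‖Y‖ ^ 2) / ε, ((integrable_const _).add hσ).div_const _,
      fun X Y => Real.exp_le_exp.2 (neg_le_neg ?_)⟩
    have h1 := hR X X.2
    have h2 := norm_sub_le (X : EuclideanSpace ℝ (Fin d)) Y
    have h3 : ‖(X : EuclideanSpace ℝ (Fin d)) - Y‖ ^ 2 ≤ 2 * (R ^ 2 + ‖Y‖ ^ 2) := by
      have h4 : ‖(X : EuclideanSpace ℝ (Fin d)) - Y‖ ^ 2 ≤ (R + ‖Y‖) ^ 2 :=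
        pow_le_pow_left₀ (norm_nonneg _) (by linarith) 2
      nlinarith [sq_nonneg (R - ‖Y‖)]
    rw [div_le_div_iff₀ (by positivity) hε]
    nlinarith

theorem isFiniteMeasure_lebesgueOn (hΩo : IsOpen Ω) (hΩ : Bornology.IsBounded Ω) :
    IsFiniteMeasure (lebesgueOn Ω) := by
  refine ⟨?_⟩
  rw [lebesgueOn, comap_subtype_coe_apply hΩo.measurableSet]
  simpa using hΩ.measure_lt_top

theorem isOpenPosMeasure_lebesgueOn (hΩo : IsOpen Ω) : (lebesgueOn Ω).IsOpenPosMeasure := by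
  refine ⟨fun U hU hne => ?_⟩
  rw [lebesgueOn, comap_subtype_coe_apply hΩo.measurableSet]
  exact ((hΩo.isOpenMap_subtype_val U hU).measure_pos _ (hne.image _)).ne'

theorem ae_lebesgueOn_iff (hΩo : IsOpen Ω) {p : EuclideanSpace ℝ (Fin d) → Prop} :
    (∀ᵐ X : Ω ∂lebesgueOn Ω, p X) ↔ ∀ᵐ X ∂volume, X ∈ Ω → p X := by
  rw [← ae_restrict_iff' hΩo.measurableSet, ← map_comap_subtype_coe hΩo.measurableSet,
    (MeasurableEmbedding.subtype_coe hΩo.measurableSet).ae_map_iff]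
  rfl

end Kernel

/-! ### Finiteness and continuity of Gaussian-weighted Laplace transforms on `Ω` -/

section Laplace

variable {d : ℕ} {Ω : Set (EuclideanSpace ℝ (Fin d))}

open scoped RealInnerProductSpace

theorem gibbsKernel_eq {ε : ℝ} (X Y : EuclideanSpace ℝ (Fin d)) :
    gibbsKernel ε X Y = Real.exp (-(‖X‖ ^ 2 / (2 * ε))) *
      (Real.exp (-(‖Y‖ ^ 2 / (2 * ε))) * Real.exp (⟪X, Y⟫ / ε)) := by
  rw [gibbsKernel, ← Real.exp_add, ← Real.exp_add, norm_sub_sq_real]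
  congr 1
  rcases eq_or_ne ε 0 with rfl | h
  · simp
  · field_simp
    ring

/-- For almost every small `v`, both `X + v` and `X - v` avoid the exceptional null set, since
translation and reflection preserve Lebesgue measure. Such a pair has midpoint `X`. -/
theorem mem_of_ae_mem_of_midpoint (hΩo : IsOpen Ω) {D : Set (EuclideanSpace ℝ (Fin d))}
    (hD : ∀ᵐ X ∂volume, X ∈ Ω → X ∈ D) (hmid : ∀ X v, X + v ∈ D → X - v ∈ D → X ∈ D)
    {X : EuclideanSpace ℝ (Fin d)} (hX : X ∈ Ω) : X ∈ D := by
  obtain ⟨r, hr, hball⟩ := Metric.isOpen_iff.1 hΩo X hX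
  have h1 : ∀ᵐ v ∂(volume : Measure (EuclideanSpace ℝ (Fin d))), X + v ∈ Ω → X + v ∈ D :=
    (measurePreserving_add_left volume X).quasiMeasurePreserving.ae hD
  have h2 : ∀ᵐ v ∂(volume : Measure (EuclideanSpace ℝ (Fin d))), X - v ∈ Ω → X - v ∈ D :=
    (Measure.measurePreserving_sub_left volume X).quasiMeasurePreserving.ae hD
  have h3 : ∃ᵐ v ∂(volume : Measure (EuclideanSpace ℝ (Fin d))), v ∈ Metric.ball 0 r :=
    frequently_ae_mem_iff.2 (Metric.measure_ball_pos _ _ hr).ne'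
  obtain ⟨v, hv, h4, h5⟩ := (h3.and_eventually (h1.and h2)).exists
  rw [mem_ball_zero_iff] at hv
  exact hmid X v (h4 (hball (by simpa [dist_eq_norm] using hv)))
    (h5 (hball (by simpa [dist_eq_norm] using hv)))

variable {σ : Measure (EuclideanSpace ℝ (Fin d))} {ε : ℝ} {w : EuclideanSpace ℝ (Fin d) → ℝ}

theorem integrable_mul_gibbsKernel_iff (X : EuclideanSpace ℝ (Fin d)) :
    Integrable (fun Y => w Y * gibbsKernel ε X Y) σ ↔
      Integrable (fun Y => w Y * Real.exp (-(‖Y‖ ^ 2 / (2 * ε))) * Real.exp (⟪X, Y⟫ / ε)) σ := by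
  conv_rhs => rw [← integrable_const_mul_iff (isUnit_iff_ne_zero.2
    (Real.exp_pos (-(‖X‖ ^ 2 / (2 * ε)))).ne')]
  refine integrable_congr (Filter.Eventually.of_forall fun Y => ?_)
  simp only [gibbsKernel_eq]
  ring

/-- Upgrades almost everywhere to everywhere. By the sign of `⟪v, Y⟫`, `exp (⟪X, Y⟫ / ε)` is at most
one of its values at `X + v` and `X - v`, hence at most their sum, so integrability passes to
midpoints. -/
theorem integrable_mul_gibbsKernel (hΩo : IsOpen Ω) (hw : Measurable w) (hw0 : ∀ Y, 0 ≤ w Y)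
    (h : ∀ᵐ X : Ω ∂lebesgueOn Ω, Integrable (fun Y => w Y * gibbsKernel ε X Y) σ)
    {X : EuclideanSpace ℝ (Fin d)} (hX : X ∈ Ω) :
    Integrable (fun Y => w Y * gibbsKernel ε X Y) σ := by
  rw [ae_lebesgueOn_iff (p := fun X => Integrable (fun Y => w Y * gibbsKernel ε X Y) σ) hΩo] at h
  refine mem_of_ae_mem_of_midpoint (D := {X | Integrable (fun Y => w Y * gibbsKernel ε X Y) σ})
    hΩo h (fun X v h1 h2 => ?_) hX
  simp only [Set.mem_ofPred_eq, integrable_mul_gibbsKernel_iff] at h1 h2 ⊢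
  refine Integrable.mono' (h1.add h2) (by fun_prop) (Filter.Eventually.of_forall fun Y => ?_)
  have h0 : 0 ≤ w Y * Real.exp (-(‖Y‖ ^ 2 / (2 * ε))) := mul_nonneg (hw0 Y) (Real.exp_pos _).le
  rw [Real.norm_of_nonneg (mul_nonneg h0 (Real.exp_pos _).le)]
  simp only [Pi.add_apply]
  rw [← mul_add]
  refine mul_le_mul_of_nonneg_left ?_ h0
  rcases le_total 0 (⟪v, Y⟫ / ε) with h3 | h3
  · refine (Real.exp_le_exp.2 ?_).trans (le_add_of_nonneg_right (Real.exp_pos _).le)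
    rw [inner_add_left, add_div]
    linarith
  · refine (Real.exp_le_exp.2 ?_).trans (le_add_of_nonneg_left (Real.exp_pos _).le)
    rw [inner_sub_left, sub_div]
    linarith

/-- Once the factor depending on `X` alone is removed, the integral is an average of exponentials of
linear functions of `X`: a finite convex function on an open convex set, hence continuous. -/
theorem continuousOn_integral_mul_gibbsKernel (hΩo : IsOpen Ω) (hΩc : Convex ℝ Ω)
    (hw0 : ∀ Y, 0 ≤ w Y) (h : ∀ X ∈ Ω, Integrable (fun Y => w Y * gibbsKernel ε X Y) σ) :
    ContinuousOn (fun X => ∫ Y, w Y * gibbsKernel ε X Y ∂σ) Ω := by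
  have heq : (fun X => ∫ Y, w Y * gibbsKernel ε X Y ∂σ) = fun X =>
      Real.exp (-(‖X‖ ^ 2 / (2 * ε))) *
        ∫ Y, w Y * Real.exp (-(‖Y‖ ^ 2 / (2 * ε))) * Real.exp (⟪X, Y⟫ / ε) ∂σ := by
    ext X
    rw [← integral_const_mul]
    congr 1 with Y
    rw [gibbsKernel_eq]
    ring
  rw [heq]
  refine ContinuousOn.mul (by fun_prop) (ConvexOn.continuousOn hΩo ⟨hΩc, ?_⟩)
  intro X hX X' hX' a b ha hb hab
  have i := (integrable_mul_gibbsKernel_iff X).1 (h X hX)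
  have i' := (integrable_mul_gibbsKernel_iff X').1 (h X' hX')
  have ic := (integrable_mul_gibbsKernel_iff _).1 (h _ (hΩc hX hX' ha hb hab))
  simp only [smul_eq_mul]
  rw [← integral_const_mul, ← integral_const_mul,
    ← integral_add (i.const_mul _) (i'.const_mul _)]
  refine integral_mono ic ((i.const_mul _).add (i'.const_mul _)) fun Y => ?_
  have h0 : 0 ≤ w Y * Real.exp (-(‖Y‖ ^ 2 / (2 * ε))) := mul_nonneg (hw0 Y) (Real.exp_pos _).le
  have h1 := convexOn_exp.2 (Set.mem_univ (⟪X, Y⟫ / ε)) (Set.mem_univ (⟪X', Y⟫ / ε)) ha hb hab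
  have h2 := mul_le_mul_of_nonneg_left h1 h0
  simp only [smul_eq_mul] at h2
  have h3 : ⟪a • X + b • X', Y⟫ / ε = a * (⟪X, Y⟫ / ε) + b * (⟪X', Y⟫ / ε) := by
    rw [inner_add_left, real_inner_smul_left, real_inner_smul_left]
    ring
  simp only
  rw [h3]
  linarith

end Laplace

/-! ### Regularity of the potentials; existence and uniqueness for the two equations -/

section Potentials

variable {d : ℕ} {Ω : Set (EuclideanSpace ℝ (Fin d))}
  {σ : Measure (EuclideanSpace ℝ (Fin d))} {f g ε : ℝ}

open scoped RealInnerProductSpace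

theorem hasFDerivAt_gibbsKernel (X Y : EuclideanSpace ℝ (Fin d)) :
    HasFDerivAt (fun Y => gibbsKernel ε X Y)
      (innerSL ℝ ((gibbsKernel ε X Y / ε) • (X - Y))) Y := by
  have h1 : HasFDerivAt (fun Y : EuclideanSpace ℝ (Fin d) => X - Y)
      (-ContinuousLinearMap.id ℝ (EuclideanSpace ℝ (Fin d))) Y := (hasFDerivAt_id Y).const_sub X
  have h2 := ((h1.norm_sq.mul_const (2 * ε)⁻¹).fun_neg).exp
  simp only [gibbsKernel, div_eq_mul_inv]
  refine h2.congr_fderiv ?_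
  ext v
  simp
  ring

theorem continuous_gibbsKernel_left (ε : ℝ) (Y : EuclideanSpace ℝ (Fin d)) :
    Continuous fun X : Ω => gibbsKernel ε X Y := by
  unfold gibbsKernel
  fun_prop

theorem hasFDerivAt_gibbsMass [IsFiniteMeasure (lebesgueOn Ω)]
    (hΩ : Bornology.IsBounded Ω) (hε : 0 < ε) {φ : Ω → ℝ}
    (hφ : Measurable φ) (hφ0 : ∀ X, φ X ≤ 0) (Y : EuclideanSpace ℝ (Fin d)) :
    HasFDerivAt (gibbsMass (lebesgueOn Ω) (kernelOn Ω ε) ε φ)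
      (innerSL ℝ (∫ X : Ω, (Real.exp (φ X / ε) * kernelOn Ω ε X Y / ε) •
        ((X : EuclideanSpace ℝ (Fin d)) - Y) ∂lebesgueOn Ω)) Y := by
  obtain ⟨R, hR⟩ := hΩ.exists_norm_le
  have hcont : ∀ Y, Continuous fun X : Ω => kernelOn Ω ε X Y :=
    continuous_gibbsKernel_left ε
  -- A bound uniform in `X`, from boundedness of `Ω` and `exp (φ / ε) K ≤ 1`; it justifies
  -- differentiating under the integral near `Y`.
  have hbound : ∀ X : Ω, ∀ Y' ∈ Metric.ball Y 1,
      ‖(Real.exp (φ X / ε) * kernelOn Ω ε X Y' / ε) • ((X : EuclideanSpace ℝ (Fin d)) - Y')‖ ≤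
        ε⁻¹ * (R + (‖Y‖ + 1)) := by
    intro X Y' hY'
    have h1 : 0 < Real.exp (φ X / ε) * kernelOn Ω ε X Y' :=
      mul_pos (Real.exp_pos _) (gibbsKernel_pos _ _ _)
    have h2 : Real.exp (φ X / ε) * kernelOn Ω ε X Y' ≤ 1 :=
      mul_le_one₀ (exp_div_le_one hε (hφ0 X)) (gibbsKernel_pos _ _ _).le
        (gibbsKernel_le_one hε _ _)
    have h3 : ‖Y'‖ ≤ ‖Y‖ + 1 := by
      have h4 := norm_le_norm_add_norm_sub' Y' Y
      rw [Metric.mem_ball, dist_eq_norm] at hY'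
      linarith
    rw [norm_smul, Real.norm_of_nonneg (by positivity)]
    refine mul_le_mul ?_ ?_ (norm_nonneg _) (by positivity)
    · rw [div_eq_mul_inv]
      exact mul_le_of_le_one_left (by positivity) h2
    · exact (norm_sub_le _ _).trans (add_le_add (hR X X.2) h3)
  have hmeas : AEStronglyMeasurable (fun X : Ω => (Real.exp (φ X / ε) * kernelOn Ω ε X Y / ε) •
      ((X : EuclideanSpace ℝ (Fin d)) - Y)) (lebesgueOn Ω) := by
    have h1 := (hcont Y).measurable
    have h2 : Measurable fun X : Ω => Real.exp (φ X / ε) * kernelOn Ω ε X Y / ε := by fun_prop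
    exact (h2.smul (measurable_subtype_coe.sub measurable_const)).aestronglyMeasurable
  have hint : Integrable (fun X : Ω => (Real.exp (φ X / ε) * kernelOn Ω ε X Y / ε) •
      ((X : EuclideanSpace ℝ (Fin d)) - Y)) (lebesgueOn Ω) :=
    Integrable.of_bound hmeas _ (Filter.Eventually.of_forall fun X =>
      hbound X Y (Metric.mem_ball_self one_pos))
  have key := hasFDerivAt_integral_of_dominated_of_fderiv_le (𝕜 := ℝ) (μ := lebesgueOn Ω)
    (F := fun Y (X : Ω) => Real.exp (φ X / ε) * kernelOn Ω ε X Y)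
    (F' := fun Y (X : Ω) => innerSL ℝ ((Real.exp (φ X / ε) * kernelOn Ω ε X Y / ε) •
      ((X : EuclideanSpace ℝ (Fin d)) - Y))) (x₀ := Y)
    (bound := fun _ => ε⁻¹ * (R + (‖Y‖ + 1)))
    (Metric.ball_mem_nhds Y one_pos) ?_ ?_ ?_ ?_ (integrable_const _) ?_
  · rwa [(innerSL ℝ).integral_comp_comm hint] at key
  · refine Filter.Eventually.of_forall fun Y' => ?_
    have := (hcont Y').measurable
    exact Measurable.aestronglyMeasurable (by fun_prop)
  · have := (hcont Y).measurable
    refine Integrable.of_bound (Measurable.aestronglyMeasurable (by fun_prop)) 1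
      (Filter.Eventually.of_forall fun X => ?_)
    have hpos : 0 < Real.exp (φ X / ε) * kernelOn Ω ε X Y :=
      mul_pos (Real.exp_pos _) (gibbsKernel_pos _ _ _)
    rw [Real.norm_of_nonneg hpos.le]
    exact mul_le_one₀ (exp_div_le_one hε (hφ0 X)) (gibbsKernel_pos _ _ _).le
        (gibbsKernel_le_one hε _ _)
  · exact (innerSL ℝ).continuous.comp_aestronglyMeasurable hmeas
  · refine Filter.Eventually.of_forall fun X Y' hY' => ?_
    rw [innerSL_apply_norm]
    exact hbound X Y' hY'
  · refine Filter.Eventually.of_forall fun X Y' _ => ?_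
    have h1 := (hasFDerivAt_gibbsKernel (ε := ε) (X : EuclideanSpace ℝ (Fin d)) Y').const_mul
      (Real.exp (φ X / ε))
    refine h1.congr_fderiv ?_
    rw [← map_smul, smul_smul, mul_div_assoc]
    rfl

theorem exp_div_eq_inv_of_logSumExp [IsFiniteMeasure (lebesgueOn Ω)] [NeZero (lebesgueOn Ω)]
    (hK : IsGibbsLike σ (kernelOn Ω ε)) (hε : 0 < ε) {φ : C(Ω, ℝ)}
    {ψ : C(EuclideanSpace ℝ (Fin d), ℝ)} (hφ0 : ∀ X, φ X ≤ 0) {Y : EuclideanSpace ℝ (Fin d)}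
    (h : LogSumExpEquation ε φ ψ Y) :
    Real.exp (ψ Y / ε) = (gibbsMass (lebesgueOn Ω) (kernelOn Ω ε) ε φ Y)⁻¹ := by
  have hp := gibbsMass_pos (μ := lebesgueOn Ω) hK hε φ.continuous.measurable hφ0 Y
  have h1 : ψ Y = -ε * Real.log (gibbsMass (lebesgueOn Ω) (kernelOn Ω ε) ε φ Y) := h
  rw [h1, neg_mul, neg_div, mul_div_cancel_left₀ _ hε.ne', Real.exp_neg, Real.exp_log hp]

theorem planDensity_eq_of_logSumExp [IsFiniteMeasure (lebesgueOn Ω)] [NeZero (lebesgueOn Ω)]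
    (hK : IsGibbsLike σ (kernelOn Ω ε)) (hε : 0 < ε) {φ : C(Ω, ℝ)}
    {ψ : C(EuclideanSpace ℝ (Fin d), ℝ)} (hφ0 : ∀ X, φ X ≤ 0) {Y : EuclideanSpace ℝ (Fin d)}
    (h : LogSumExpEquation ε φ ψ Y) (X : Ω) :
    planDensity ε φ ψ X Y = Real.exp (φ X / ε) *
      ((gibbsMass (lebesgueOn Ω) (kernelOn Ω ε) ε φ Y)⁻¹ * kernelOn Ω ε X Y) := by
  rw [planDensity, add_div, Real.exp_add, exp_div_eq_inv_of_logSumExp hK hε hφ0 h, mul_assoc]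
  rfl

theorem integral_planDensity_eq_one [IsFiniteMeasure (lebesgueOn Ω)] [NeZero (lebesgueOn Ω)]
    (hK : IsGibbsLike σ (kernelOn Ω ε)) (hε : 0 < ε) {φ : C(Ω, ℝ)}
    {ψ : C(EuclideanSpace ℝ (Fin d), ℝ)} (hφ0 : ∀ X, φ X ≤ 0) {Y : EuclideanSpace ℝ (Fin d)}
    (h : LogSumExpEquation ε φ ψ Y) : ∫ X, planDensity ε φ ψ X Y ∂lebesgueOn Ω = 1 := by
  simp only [planDensity_eq_of_logSumExp hK hε hφ0 h]
  exact integral_normalised_eq_one hK hε φ.continuous.measurable hφ0 Y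

theorem integrable_planDensity_smul [IsFiniteMeasure (lebesgueOn Ω)] (hε : 0 < ε)
    (hΩ : Bornology.IsBounded Ω) {φ : C(Ω, ℝ)}
    {ψ : C(EuclideanSpace ℝ (Fin d), ℝ)} (hφ0 : ∀ X, φ X ≤ 0) (Y : EuclideanSpace ℝ (Fin d)) :
    Integrable (fun X => planDensity ε φ ψ X Y) (lebesgueOn Ω) ∧
    Integrable (fun X : Ω => planDensity ε φ ψ X Y • (X : EuclideanSpace ℝ (Fin d)))
      (lebesgueOn Ω) := by
  obtain ⟨R, hR⟩ := hΩ.exists_norm_le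
  have hc : Continuous fun X => planDensity ε φ ψ X Y := by
    unfold planDensity
    exact Continuous.mul (by fun_prop) (continuous_gibbsKernel_left ε Y)
  have hi : Integrable (fun X => planDensity ε φ ψ X Y) (lebesgueOn Ω) := by
    refine Integrable.of_bound hc.aestronglyMeasurable (Real.exp (ψ Y / ε))
      (Filter.Eventually.of_forall fun X => ?_)
    rw [planDensity, add_div, Real.exp_add, Real.norm_of_nonneg
      (mul_pos (by positivity) (gibbsKernel_pos _ _ _)).le]
    have h1 := mul_le_one₀ (exp_div_le_one hε (hφ0 X))
      (gibbsKernel_pos ε (X : EuclideanSpace ℝ (Fin d)) Y).le (gibbsKernel_le_one hε _ _)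
    have h2 := mul_le_mul_of_nonneg_left h1 (Real.exp_pos (ψ Y / ε)).le
    linarith
  refine ⟨hi, ?_⟩
  exact hi.smul_bdd R measurable_subtype_coe.aestronglyMeasurable
    (Filter.Eventually.of_forall fun X => hR X X.2)

/-- `∇ψ = -ε ∇Z / Z` is the average of `Y - X` under the density `planDensity ε φ ψ · Y`, which has
mass one. -/
theorem hasGradientAt_of_logSumExp [IsFiniteMeasure (lebesgueOn Ω)] [NeZero (lebesgueOn Ω)]
    (hΩ : Bornology.IsBounded Ω)
    (hK : IsGibbsLike σ (kernelOn Ω ε)) (hε : 0 < ε) {φ : C(Ω, ℝ)}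
    {ψ : C(EuclideanSpace ℝ (Fin d), ℝ)} (hφ0 : ∀ X, φ X ≤ 0)
    (h : ∀ Y, LogSumExpEquation ε φ ψ Y) (Y : EuclideanSpace ℝ (Fin d)) :
    HasGradientAt ψ (Y - barycentre ε φ ψ Y) Y := by
  have hp := gibbsMass_pos (μ := lebesgueOn Ω) hK hε φ.continuous.measurable hφ0 Y
  have h1 := ((hasFDerivAt_gibbsMass hΩ hε φ.continuous.measurable hφ0 Y).log
    hp.ne').const_mul (-ε)
  have h2 : (ψ : EuclideanSpace ℝ (Fin d) → ℝ) = fun Y =>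
      -ε * Real.log (gibbsMass (lebesgueOn Ω) (kernelOn Ω ε) ε φ Y) := funext h
  rw [hasGradientAt_iff_hasFDerivAt, h2]
  refine h1.congr_fderiv ?_
  rw [← map_smul, ← map_smul, ← integral_smul, ← integral_smul]
  change _ = innerSL ℝ _
  congr 1
  obtain ⟨i1, i2⟩ := integrable_planDensity_smul (ψ := ψ) hε hΩ hφ0 Y
  have h3 : ∀ X : Ω, -ε • (gibbsMass (lebesgueOn Ω) (kernelOn Ω ε) ε φ Y)⁻¹ •
      (Real.exp (φ X / ε) * kernelOn Ω ε X Y / ε) • ((X : EuclideanSpace ℝ (Fin d)) - Y) =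
      planDensity ε φ ψ X Y • Y - planDensity ε φ ψ X Y • (X : EuclideanSpace ℝ (Fin d)) := by
    intro X
    rw [planDensity_eq_of_logSumExp hK hε hφ0 (h Y), ← smul_sub, smul_smul, smul_smul,
      ← neg_sub Y, smul_neg, ← neg_smul]
    congr 1
    field_simp
  simp only [h3]
  rw [integral_sub (i1.smul_const Y) i2, integral_smul_const,
    integral_planDensity_eq_one hK hε hφ0 (h Y), one_smul, barycentre]

theorem nonpos_of_lambert (hg : 0 < g) (hε : 0 < ε) {φ : C(Ω, ℝ)}
    {ψ : C(EuclideanSpace ℝ (Fin d), ℝ)} {X : Ω} (h : LambertEquation σ f g ε φ ψ X) :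
    φ X ≤ 0 := by
  rw [LambertEquation] at h
  rw [h]
  have h1 : 0 ≤ ∫ Y, Real.exp (ψ Y / ε) * gibbsKernel ε X Y ∂σ :=
    integral_nonneg fun Y => mul_nonneg (Real.exp_pos _).le (gibbsKernel_pos _ _ _).le
  have h2 := lambertW0_nonneg (mul_nonneg (by positivity : 0 ≤ g / (ε * f ^ 2)) h1)
  nlinarith

/-- `σ` is carried by its support, so the log-sum-exp equation there suffices to replace `exp (ψ /
ε)` by the inverse mass. -/
theorem integral_exp_mul_gibbsKernel_eq [IsFiniteMeasure (lebesgueOn Ω)] [NeZero (lebesgueOn Ω)]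
    (hK : IsGibbsLike σ (kernelOn Ω ε)) (hε : 0 < ε) {φ : C(Ω, ℝ)}
    {ψ : C(EuclideanSpace ℝ (Fin d), ℝ)} (hφ0 : ∀ X, φ X ≤ 0)
    (h : ∀ Y ∈ σ.support, LogSumExpEquation ε φ ψ Y) (X : Ω) :
    ∫ Y, Real.exp (ψ Y / ε) * gibbsKernel ε X Y ∂σ =
      normalisedKernel (lebesgueOn Ω) σ (kernelOn Ω ε) ε φ X := by
  refine integral_congr_ae ?_
  filter_upwards [Measure.support_mem_ae] with Y hY
  rw [exp_div_eq_inv_of_logSumExp hK hε hφ0 (h Y hY)]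
  rfl

/-- The Lambert equation says that `-(f² / g) φ` is the first marginal of the plan. -/
theorem marginal_eq_of_equations [IsFiniteMeasure (lebesgueOn Ω)] [NeZero (lebesgueOn Ω)]
    (hK : IsGibbsLike σ (kernelOn Ω ε)) (hf : f ≠ 0) (hg : 0 < g) (hε : 0 < ε) {φ : C(Ω, ℝ)}
    {ψ : C(EuclideanSpace ℝ (Fin d), ℝ)}
    (h : ∀ Y ∈ σ.support, LogSumExpEquation ε φ ψ Y)
    (h' : ∀ X, LambertEquation σ f g ε φ ψ X) (X : Ω) :
    Real.exp (φ X / ε) * normalisedKernel (lebesgueOn Ω) σ (kernelOn Ω ε) ε φ X =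
      -(f ^ 2 / g) * φ X := by
  have hφ0 := fun X => nonpos_of_lambert hg hε (h' X)
  refine exp_mul_eq_of_lambert hf hg hε
    (normalisedKernel_nonneg hK hε φ.continuous.measurable hφ0 X) ?_
  rw [← integral_exp_mul_gibbsKernel_eq hK hε hφ0 h]
  exact h' X

theorem eq_of_equations [IsFiniteMeasure (lebesgueOn Ω)] [NeZero (lebesgueOn Ω)]
    [(lebesgueOn Ω).IsOpenPosMeasure] [IsFiniteMeasure σ]
    (hK : IsGibbsLike σ (kernelOn Ω ε)) (hf : f ≠ 0) (hg : 0 < g) (hε : 0 < ε)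
    {φ φ' : C(Ω, ℝ)} {ψ ψ' : C(EuclideanSpace ℝ (Fin d), ℝ)}
    (h1 : ∀ Y ∈ σ.support, LogSumExpEquation ε φ ψ Y) (h2 : ∀ X, LambertEquation σ f g ε φ ψ X)
    (h1' : ∀ Y ∈ σ.support, LogSumExpEquation ε φ' ψ' Y)
    (h2' : ∀ X, LambertEquation σ f g ε φ' ψ' X) : φ' = φ := by
  have := ae_eq_of_marginal_eq (μ := lebesgueOn Ω) hK hε (κ := f ^ 2 / g) (by positivity)
    φ'.continuous.measurable (fun X => nonpos_of_lambert hg hε (h2' X))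
    φ.continuous.measurable (fun X => nonpos_of_lambert hg hε (h2 X))
    (Filter.Eventually.of_forall (marginal_eq_of_equations hK hf hg hε h1' h2'))
    (Filter.Eventually.of_forall (marginal_eq_of_equations hK hf hg hε h1 h2))
  exact DFunLike.coe_injective (Measure.eq_of_ae_eq this φ'.continuous φ.continuous)

theorem exists_solution [IsFiniteMeasure (lebesgueOn Ω)] [NeZero (lebesgueOn Ω)]
    [IsProbabilityMeasure σ] (hΩo : IsOpen Ω) (hΩc : Convex ℝ Ω) (hΩ : Bornology.IsBounded Ω)
    (hK : IsGibbsLike σ (kernelOn Ω ε)) (hf : f ≠ 0) (hg : 0 < g) (hε : 0 < ε) :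
    ∃ (φ : C(Ω, ℝ)) (ψ : C(EuclideanSpace ℝ (Fin d), ℝ)),
      (∀ Y, LogSumExpEquation ε φ ψ Y) ∧ (∀ X, LambertEquation σ f g ε φ ψ X) ∧
        MemLp φ 2 (lebesgueOn Ω) := by
  obtain ⟨φ₀, hφ₀, hmax⟩ := exists_isMax_reducedDual (μ := lebesgueOn Ω) (κ := f ^ 2 / g)
    hK hε (by positivity)
  set Z := gibbsMass (lebesgueOn Ω) (kernelOn Ω ε) ε φ₀ with hZ
  have hZpos : ∀ Y, 0 < Z Y := gibbsMass_pos hK hε hφ₀.measurable hφ₀.nonpos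
  have hZm : Measurable Z := measurable_gibbsMass hK hφ₀.measurable
  have hZinv : ∀ Y, 0 ≤ (Z Y)⁻¹ := fun Y => (inv_pos.2 (hZpos Y)).le
  have hZc : Continuous Z := continuous_iff_continuousAt.2 fun Y =>
    (hasFDerivAt_gibbsMass hΩ hε hφ₀.measurable hφ₀.nonpos Y).continuousAt
  have hint : ∀ X ∈ Ω, Integrable (fun Y => (Z Y)⁻¹ * gibbsKernel ε X Y) σ := fun X hX =>
    integrable_mul_gibbsKernel hΩo hZm.inv hZinv
      (ae_integrable_normalisedKernel hK hε hφ₀.measurable hφ₀.nonpos) hX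
  have hGc : Continuous (normalisedKernel (lebesgueOn Ω) σ (kernelOn Ω ε) ε φ₀) :=
    continuousOn_iff_continuous_domRestrict.1
      (continuousOn_integral_mul_gibbsKernel hΩo hΩc hZinv hint)
  have hG0 := normalisedKernel_nonneg (μ := lebesgueOn Ω) hK hε hφ₀.measurable hφ₀.nonpos
  have hc : 0 ≤ g / (ε * f ^ 2) := by positivity
  -- The Lambert transform of the merely measurable maximiser `φ₀`. It is continuous and agrees with
  -- `φ₀` almost everywhere, so `Z` and `G` are unchanged and the equations hold at every point.
  let φ : C(Ω, ℝ) := ⟨fun X => -ε * lambertW0 (g / (ε * f ^ 2) *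
    normalisedKernel (lebesgueOn Ω) σ (kernelOn Ω ε) ε φ₀ X),
    continuous_const.mul (continuousOn_lambertW0.comp_continuous (continuous_const.mul hGc)
      fun X => mul_nonneg hc (hG0 X))⟩
  have hφ0 : ∀ X, φ X ≤ 0 := fun X => by
    have := lambertW0_nonneg (mul_nonneg hc (hG0 X))
    change -ε * lambertW0 _ ≤ 0
    nlinarith
  have hae : φ₀ =ᵐ[lebesgueOn Ω] φ :=
    ae_eq_of_isMax_reducedDual hK hε (by positivity) hφ₀ hmax φ.continuous.measurable hφ0
      fun X => exp_mul_eq_of_lambert hf hg hε (hG0 X) rfl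
  have hZφ : gibbsMass (lebesgueOn Ω) (kernelOn Ω ε) ε φ = Z := by
    ext Y
    refine integral_congr_ae ?_
    filter_upwards [hae] with X hX
    rw [hX]
  let ψ : C(EuclideanSpace ℝ (Fin d), ℝ) := ⟨fun Y => -ε * Real.log (Z Y),
    continuous_const.mul (hZc.log fun Y => (hZpos Y).ne')⟩
  have hψ : ∀ Y, LogSumExpEquation ε φ ψ Y := fun Y => by
    change -ε * Real.log (Z Y) = -ε * Real.log (gibbsMass (lebesgueOn Ω) (kernelOn Ω ε) ε φ Y)
    rw [hZφ]
  refine ⟨φ, ψ, hψ, fun X => ?_, hφ₀.memLp.ae_eq hae⟩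
  rw [LambertEquation, integral_exp_mul_gibbsKernel_eq hK hε hφ0 (fun Y _ => hψ Y),
    normalisedKernel, hZφ]
  rfl

end Potentials

/-! ### The plan at equilibrium and the Bregman identity -/

section Plan

variable {d : ℕ} {Ω : Set (EuclideanSpace ℝ (Fin d))}
  {σ : Measure (EuclideanSpace ℝ (Fin d))} {f g ε : ℝ}
  {φ φ' : C(Ω, ℝ)} {ψ ψ' : C(EuclideanSpace ℝ (Fin d), ℝ)}

theorem continuous_planDensity (ε : ℝ) (φ : C(Ω, ℝ)) (ψ : C(EuclideanSpace ℝ (Fin d), ℝ)) :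
    Continuous fun p : Ω × EuclideanSpace ℝ (Fin d) => planDensity ε φ ψ p.1 p.2 := by
  unfold planDensity gibbsKernel
  fun_prop

theorem planDensity_pos (ε : ℝ) (φ : C(Ω, ℝ)) (ψ : C(EuclideanSpace ℝ (Fin d), ℝ)) (X : Ω)
    (Y : EuclideanSpace ℝ (Fin d)) : 0 < planDensity ε φ ψ X Y :=
  mul_pos (Real.exp_pos _) (gibbsKernel_pos _ _ _)

/-- The optimality equations in terms of the plan: its marginals are `h μ` and `σ`, where `h` is
the water height of `φ`. -/
structure IsEquilibrium (σ : Measure (EuclideanSpace ℝ (Fin d))) (f g ε : ℝ)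
    (φ : C(Ω, ℝ)) (ψ : C(EuclideanSpace ℝ (Fin d), ℝ)) : Prop where
  nonpos : ∀ X, φ X ≤ 0
  memLp : MemLp φ 2 (lebesgueOn Ω)
  integrable_snd : Integrable ψ σ
  integrable : Integrable (fun p : Ω × EuclideanSpace ℝ (Fin d) => planDensity ε φ ψ p.1 p.2)
    ((lebesgueOn Ω).prod σ)
  integral_fst : ∀ Y, ∫ X, planDensity ε φ ψ X Y ∂lebesgueOn Ω = 1
  integral_snd : ∀ X, ∫ Y, planDensity ε φ ψ X Y ∂σ = waterHeight f g φ X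

theorem isEquilibrium_of_equations [IsFiniteMeasure (lebesgueOn Ω)] [NeZero (lebesgueOn Ω)]
    [IsFiniteMeasure σ] (hK : IsGibbsLike σ (kernelOn Ω ε)) (hf : f ≠ 0) (hg : 0 < g) (hε : 0 < ε)
    (h1 : ∀ Y, LogSumExpEquation ε φ ψ Y) (h2 : ∀ X, LambertEquation σ f g ε φ ψ X)
    (h3 : MemLp φ 2 (lebesgueOn Ω)) : IsEquilibrium σ f g ε φ ψ := by
  have hφ0 := fun X => nonpos_of_lambert hg hε (h2 X)
  have hφm := φ.continuous.measurable
  refine ⟨hφ0, h3, ?_, ?_, fun Y => integral_planDensity_eq_one hK hε hφ0 (h1 Y), fun X => ?_⟩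
  · have : (ψ : EuclideanSpace ℝ (Fin d) → ℝ) = fun Y =>
      -ε * Real.log (gibbsMass (lebesgueOn Ω) (kernelOn Ω ε) ε φ Y) := funext h1
    rw [this]
    exact (integrable_log_gibbsMass hK hε hφm hφ0).const_mul _
  · simp only [planDensity_eq_of_logSumExp hK hε hφ0 (h1 _)]
    exact integrable_normalised_prod hK hε hφm hφ0
  · simp only [planDensity_eq_of_logSumExp hK hε hφ0 (h1 _)]
    rw [integral_const_mul]
    exact marginal_eq_of_equations hK hf hg hε (fun Y _ => h1 Y) h2 X

namespace IsEquilibrium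

theorem waterHeight_nonneg (h : IsEquilibrium σ f g ε φ ψ) (X : Ω) : 0 ≤ waterHeight f g φ X := by
  rw [← h.integral_snd]
  exact integral_nonneg fun Y => (planDensity_pos _ _ _ _ _).le

theorem integrable_section [IsFiniteMeasure (lebesgueOn Ω)]
    (h : IsEquilibrium σ f g ε φ ψ) (Y : EuclideanSpace ℝ (Fin d)) :
    Integrable (fun X => planDensity ε φ ψ X Y) (lebesgueOn Ω) := by
  -- The integral of a non-integrable function is zero by convention, so the value one in
  -- `integral_fst` already contains integrability.
  refine Integrable.of_integral_ne_zero ?_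
  rw [h.integral_fst]
  exact one_ne_zero

theorem integrable_mul_snd [IsFiniteMeasure (lebesgueOn Ω)] [IsFiniteMeasure σ]
    (h : IsEquilibrium σ f g ε φ ψ)
    (hψ' : Integrable ψ' σ) : Integrable (fun p : Ω × EuclideanSpace ℝ (Fin d) =>
      planDensity ε φ ψ p.1 p.2 * ψ' p.2) ((lebesgueOn Ω).prod σ) := by
  have hc : Continuous fun p : Ω × EuclideanSpace ℝ (Fin d) =>
      planDensity ε φ ψ p.1 p.2 * ψ' p.2 :=
    (continuous_planDensity ε φ ψ).mul (ψ'.continuous.comp continuous_snd)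
  refine (integrable_prod_iff' hc.aestronglyMeasurable).2 ⟨?_, ?_⟩
  · exact Filter.Eventually.of_forall fun Y => (h.integrable_section Y).mul_const (ψ' Y)
  · refine hψ'.abs.congr (Filter.Eventually.of_forall fun Y => ?_)
    simp only [norm_mul, Real.norm_eq_abs, abs_of_pos (planDensity_pos _ _ _ _ _)]
    rw [integral_mul_const, h.integral_fst, one_mul]

theorem integral_mul_snd [IsFiniteMeasure (lebesgueOn Ω)] [IsFiniteMeasure σ]
    (h : IsEquilibrium σ f g ε φ ψ)
    (hψ' : Integrable ψ' σ) : ∫ p : Ω × EuclideanSpace ℝ (Fin d),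
      planDensity ε φ ψ p.1 p.2 * ψ' p.2 ∂(lebesgueOn Ω).prod σ = ∫ Y, ψ' Y ∂σ := by
  rw [integral_prod_symm _ (h.integrable_mul_snd hψ')]
  simp only [integral_mul_const, h.integral_fst, one_mul]

theorem integrable_mul_fst [IsFiniteMeasure (lebesgueOn Ω)] [IsFiniteMeasure σ]
    (h : IsEquilibrium σ f g ε φ ψ)
    (hφ' : Integrable (fun X => φ' X * waterHeight f g φ X) (lebesgueOn Ω)) :
    Integrable (fun p : Ω × EuclideanSpace ℝ (Fin d) =>
      planDensity ε φ ψ p.1 p.2 * φ' p.1) ((lebesgueOn Ω).prod σ) := by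
  have hc : Continuous fun p : Ω × EuclideanSpace ℝ (Fin d) =>
      planDensity ε φ ψ p.1 p.2 * φ' p.1 :=
    (continuous_planDensity ε φ ψ).mul (φ'.continuous.comp continuous_fst)
  refine (integrable_prod_iff hc.aestronglyMeasurable).2 ⟨?_, ?_⟩
  · filter_upwards [h.integrable.prod_right_ae] with X hX
    exact hX.mul_const (φ' X)
  · refine hφ'.abs.congr (Filter.Eventually.of_forall fun X => ?_)
    simp only [norm_mul, Real.norm_eq_abs, abs_of_pos (planDensity_pos _ _ _ _ _)]
    rw [integral_mul_const, h.integral_snd, abs_mul, abs_of_nonneg (h.waterHeight_nonneg X),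
      mul_comm]

theorem integral_mul_fst [IsFiniteMeasure (lebesgueOn Ω)] [IsFiniteMeasure σ]
    (h : IsEquilibrium σ f g ε φ ψ)
    (hφ' : Integrable (fun X => φ' X * waterHeight f g φ X) (lebesgueOn Ω)) :
    ∫ p : Ω × EuclideanSpace ℝ (Fin d), planDensity ε φ ψ p.1 p.2 * φ' p.1
      ∂(lebesgueOn Ω).prod σ = ∫ X, φ' X * waterHeight f g φ X ∂lebesgueOn Ω := by
  rw [integral_prod _ (h.integrable_mul_fst hφ')]
  simp only [integral_mul_const, h.integral_snd]
  congr 1 with X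
  ring

theorem integral_waterHeight [IsFiniteMeasure (lebesgueOn Ω)] [IsProbabilityMeasure σ]
    (h : IsEquilibrium σ f g ε φ ψ) : ∫ X, waterHeight f g φ X ∂lebesgueOn Ω = 1 := by
  simp only [← h.integral_snd]
  rw [← integral_prod _ h.integrable, integral_prod_symm _ h.integrable]
  simp only [h.integral_fst, integral_const, probReal_univ, one_smul]

theorem memLp_waterHeight (h : IsEquilibrium σ f g ε φ ψ) :
    MemLp (waterHeight f g φ) 2 (lebesgueOn Ω) :=
  h.memLp.const_mul _

theorem integrable_sub_one [IsFiniteMeasure (lebesgueOn Ω)] [IsFiniteMeasure σ]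
    (h : IsEquilibrium σ f g ε φ ψ) : Integrable (fun p : Ω × EuclideanSpace ℝ (Fin d) =>
      planDensity ε φ ψ p.1 p.2 - 1) ((lebesgueOn Ω).prod σ) :=
  h.integrable.sub (integrable_const _)

end IsEquilibrium

/-- The finite part of `otObjective`. -/
def otValue (σ : Measure (EuclideanSpace ℝ (Fin d))) (ε : ℝ) (h : Ω → ℝ)
    (φ : C(Ω, ℝ)) (ψ : C(EuclideanSpace ℝ (Fin d), ℝ)) : ℝ :=
  (∫ Y, ψ Y ∂σ) + (∫ X, φ X * h X ∂(lebesgueOn Ω))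
    - ε * ∫ p : Ω × EuclideanSpace ℝ (Fin d), (planDensity ε φ ψ p.1 p.2 - 1)
      ∂((lebesgueOn Ω).prod σ)

/-- The finite part of `dualObjective`. -/
def dualValue (σ : Measure (EuclideanSpace ℝ (Fin d))) (f g ε : ℝ)
    (φ : C(Ω, ℝ)) (ψ : C(EuclideanSpace ℝ (Fin d), ℝ)) : ℝ :=
  (∫ Y, ψ Y ∂σ) - f ^ 2 / (2 * g) * (∫ X, φ X ^ 2 ∂(lebesgueOn Ω))
    - ε * ∫ p : Ω × EuclideanSpace ℝ (Fin d), (planDensity ε φ ψ p.1 p.2 - 1)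
      ∂((lebesgueOn Ω).prod σ)

/-- The pointwise defect in the tangent inequality for the exponential. -/
def bregmanGap (ε : ℝ) (φ : C(Ω, ℝ)) (ψ : C(EuclideanSpace ℝ (Fin d), ℝ))
    (φ' : C(Ω, ℝ)) (ψ' : C(EuclideanSpace ℝ (Fin d), ℝ))
    (p : Ω × EuclideanSpace ℝ (Fin d)) : ℝ :=
  ε * (planDensity ε φ' ψ' p.1 p.2 - planDensity ε φ ψ p.1 p.2) -
    planDensity ε φ ψ p.1 p.2 * (φ' p.1 + ψ' p.2 - (φ p.1 + ψ p.2))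

theorem planDensity_eq_mul (ε : ℝ) (φ φ' : C(Ω, ℝ)) (ψ ψ' : C(EuclideanSpace ℝ (Fin d), ℝ))
    (X : Ω) (Y : EuclideanSpace ℝ (Fin d)) : planDensity ε φ' ψ' X Y =
      planDensity ε φ ψ X Y * Real.exp ((φ' X + ψ' Y - (φ X + ψ Y)) / ε) := by
  have h : (φ' X + ψ' Y) / ε = (φ X + ψ Y) / ε + (φ' X + ψ' Y - (φ X + ψ Y)) / ε := by ring
  rw [planDensity, planDensity, h, Real.exp_add]
  ring

theorem bregmanGap_eq (hε : 0 < ε) (p : Ω × EuclideanSpace ℝ (Fin d)) :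
    bregmanGap ε φ ψ φ' ψ' p = ε * planDensity ε φ ψ p.1 p.2 *
      (Real.exp ((φ' p.1 + ψ' p.2 - (φ p.1 + ψ p.2)) / ε) -
        ((φ' p.1 + ψ' p.2 - (φ p.1 + ψ p.2)) / ε + 1)) := by
  rw [bregmanGap, planDensity_eq_mul ε φ φ' ψ ψ']
  field_simp
  ring

theorem bregmanGap_nonneg (hε : 0 < ε) (p : Ω × EuclideanSpace ℝ (Fin d)) :
    0 ≤ bregmanGap ε φ ψ φ' ψ' p := by
  rw [bregmanGap_eq hε]
  exact mul_nonneg (mul_pos hε (planDensity_pos _ _ _ _ _)).le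
    (sub_nonneg.2 (Real.add_one_le_exp _))

theorem eq_of_bregmanGap_eq_zero (hε : 0 < ε) {p : Ω × EuclideanSpace ℝ (Fin d)}
    (h : bregmanGap ε φ ψ φ' ψ' p = 0) : φ' p.1 + ψ' p.2 = φ p.1 + ψ p.2 := by
  rw [bregmanGap_eq hε, mul_eq_zero_iff_left (mul_pos hε (planDensity_pos _ _ _ _ _)).ne'] at h
  by_contra hne
  have := Real.add_one_lt_exp (div_ne_zero (sub_ne_zero.2 hne) hε.ne')
  linarith

/-- In the terms linear in the potentials the plan may be replaced by its marginals `h μ` and `σ`;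
these are exactly the linear terms of the transport objective towards `h μ`. -/
theorem IsEquilibrium.integral_bregmanGap [IsFiniteMeasure (lebesgueOn Ω)] [IsFiniteMeasure σ]
    (h : IsEquilibrium σ f g ε φ ψ) (hψ' : Integrable ψ' σ)
    (hφ' : Integrable (fun X => φ' X * waterHeight f g φ X) (lebesgueOn Ω))
    (hγ' : Integrable (fun p : Ω × EuclideanSpace ℝ (Fin d) => planDensity ε φ' ψ' p.1 p.2 - 1)
      ((lebesgueOn Ω).prod σ)) :
    Integrable (bregmanGap ε φ ψ φ' ψ') ((lebesgueOn Ω).prod σ) ∧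
      ∫ p, bregmanGap ε φ ψ φ' ψ' p ∂(lebesgueOn Ω).prod σ =
        otValue σ ε (waterHeight f g φ) φ ψ - otValue σ ε (waterHeight f g φ) φ' ψ' := by
  have hφ : Integrable (fun X => φ X * waterHeight f g φ X) (lebesgueOn Ω) :=
    h.memLp.integrable_mul h.memLp_waterHeight
  have i1 := hγ'.const_mul ε
  have i2 := h.integrable_sub_one.const_mul ε
  have j1 := h.integrable_mul_fst hφ'
  have j2 := h.integrable_mul_snd hψ'
  have j3 := h.integrable_mul_fst hφ
  have j4 := h.integrable_mul_snd h.integrable_snd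
  have heq : bregmanGap ε φ ψ φ' ψ' = fun p =>
      (ε * (planDensity ε φ' ψ' p.1 p.2 - 1) - ε * (planDensity ε φ ψ p.1 p.2 - 1)) -
      ((planDensity ε φ ψ p.1 p.2 * φ' p.1 + planDensity ε φ ψ p.1 p.2 * ψ' p.2) -
        (planDensity ε φ ψ p.1 p.2 * φ p.1 + planDensity ε φ ψ p.1 p.2 * ψ p.2)) := by
    ext p
    rw [bregmanGap]
    ring
  rw [heq]
  have k1 := i1.sub i2
  have k2 := j1.add j2
  have k3 := j3.add j4
  have k4 := k2.sub k3
  refine ⟨k1.sub k4, ?_⟩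
  refine (integral_sub k1 k4).trans ?_
  rw [integral_sub' i1 i2, integral_sub' k2 k3, integral_add' j1 j2, integral_add' j3 j4,
    h.integral_mul_fst hφ', h.integral_mul_fst hφ, h.integral_mul_snd hψ',
    h.integral_mul_snd h.integrable_snd, integral_const_mul, integral_const_mul, otValue, otValue]
  ring

end Plan

/-! ### Dual and primal optimality, uniqueness, barycentric map -/

section Optimality

variable {d : ℕ} {Ω : Set (EuclideanSpace ℝ (Fin d))}
  {σ : Measure (EuclideanSpace ℝ (Fin d))} {f g ε : ℝ}
  {φ φ' : C(Ω, ℝ)} {ψ ψ' : C(EuclideanSpace ℝ (Fin d), ℝ)}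

/-- Two continuous functions differ on an open set, and an open null set misses the support. -/
theorem eqOn_support_of_ae_eq (h : ψ' =ᵐ[σ] ψ) : Set.EqOn ψ' ψ σ.support := by
  intro Y hY
  by_contra hne
  have hU : IsOpen {Y | ψ' Y ≠ ψ Y} := isOpen_ne_fun ψ'.continuous ψ.continuous
  exact ((Measure.mem_support_iff_forall Y).1 hY _ (hU.mem_nhds hne)).ne' (ae_iff.1 h)

theorem ae_eq_of_eqOn_support (h : Set.EqOn ψ' ψ σ.support) : ψ' =ᵐ[σ] ψ := by
  filter_upwards [Measure.support_mem_ae] with Y hY using h hY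

theorem dualObjective_congr [SFinite (lebesgueOn Ω)] [SFinite σ] (h : ψ' =ᵐ[σ] ψ) :
    dualObjective σ f g ε φ ψ' = dualObjective σ f g ε φ ψ := by
  have h2 : (fun p : Ω × EuclideanSpace ℝ (Fin d) => planDensity ε φ ψ' p.1 p.2 - 1)
      =ᵐ[(lebesgueOn Ω).prod σ] fun p => planDensity ε φ ψ p.1 p.2 - 1 := by
    filter_upwards [Measure.quasiMeasurePreserving_snd.ae (μa := (lebesgueOn Ω).prod σ) h]
      with p hp
    rw [planDensity, planDensity, hp]
  simp only [dualObjective]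
  rw [integral_congr_ae h, integral_congr_ae h2, integrable_congr h, integrable_congr h2]

theorem lambertEquation_congr (h : ψ' =ᵐ[σ] ψ) (X : Ω) :
    LambertEquation σ f g ε φ ψ' X ↔ LambertEquation σ f g ε φ ψ X := by
  have h2 : ∫ Y, Real.exp (ψ' Y / ε) * gibbsKernel ε X Y ∂σ =
      ∫ Y, Real.exp (ψ Y / ε) * gibbsKernel ε X Y ∂σ := by
    refine integral_congr_ae ?_
    filter_upwards [h] with Y hY
    rw [hY]
  rw [LambertEquation, LambertEquation, h2]

namespace IsEquilibrium

theorem integrable_mul_waterHeight (h : IsEquilibrium σ f g ε φ ψ)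
    (hφ' : MemLp φ' 2 (lebesgueOn Ω)) :
    Integrable (fun X => φ' X * waterHeight f g φ X) (lebesgueOn Ω) :=
  hφ'.integrable_mul h.memLp_waterHeight

theorem dualObjective_eq [IsFiniteMeasure (lebesgueOn Ω)] [IsFiniteMeasure σ]
    (h : IsEquilibrium σ f g ε φ ψ) :
    dualObjective σ f g ε φ ψ = (dualValue σ f g ε φ ψ : EReal) :=
  if_pos ⟨h.integrable_snd, h.memLp.integrable_sq, h.integrable_sub_one⟩

theorem otObjective_eq [IsFiniteMeasure (lebesgueOn Ω)] [IsFiniteMeasure σ]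
    (h : IsEquilibrium σ f g ε φ ψ) {η : Ω → ℝ} (hη : MemLp η 2 (lebesgueOn Ω)) :
    otObjective σ ε η φ ψ = (otValue σ ε η φ ψ : EReal) :=
  if_pos ⟨h.integrable_snd, h.memLp.integrable_mul hη, h.integrable_sub_one⟩

/-- Since `h = -(f² / g) φ`, the first-order term `∫ (φ' - φ) h` completes the square in the
difference of the quadratic terms; the rest is the transport deficit. -/
theorem dualValue_add [IsFiniteMeasure (lebesgueOn Ω)] [IsFiniteMeasure σ] (hg : 0 < g)
    (h : IsEquilibrium σ f g ε φ ψ) (hψ' : Integrable ψ' σ)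
    (hφ' : MemLp φ' 2 (lebesgueOn Ω))
    (hγ' : Integrable (fun p : Ω × EuclideanSpace ℝ (Fin d) => planDensity ε φ' ψ' p.1 p.2 - 1)
      ((lebesgueOn Ω).prod σ)) :
    dualValue σ f g ε φ' ψ' + f ^ 2 / (2 * g) * (∫ X, (φ' X - φ X) ^ 2 ∂lebesgueOn Ω) +
      ∫ p, bregmanGap ε φ ψ φ' ψ' p ∂(lebesgueOn Ω).prod σ = dualValue σ f g ε φ ψ := by
  rw [(h.integral_bregmanGap hψ' (h.integrable_mul_waterHeight hφ') hγ').2]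
  have e1 := integral_sub_sq hφ' h.memLp
  have e2 : ∀ ρ : C(Ω, ℝ), ∫ X, ρ X * waterHeight f g φ X ∂lebesgueOn Ω =
      -(f ^ 2 / g) * ∫ X, ρ X * φ X ∂lebesgueOn Ω := by
    intro ρ
    rw [← integral_const_mul]
    congr 1 with X
    rw [waterHeight]
    ring
  rw [e1, otValue, otValue, dualValue, dualValue, e2, e2]
  simp only [← sq]
  field_simp
  ring

theorem isDualMaximiser [IsFiniteMeasure (lebesgueOn Ω)] [IsFiniteMeasure σ] (hg : 0 < g)
    (hε : 0 < ε) (h : IsEquilibrium σ f g ε φ ψ) : IsDualMaximiser σ f g ε φ ψ := by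
  intro φ' ψ'
  rw [h.dualObjective_eq, dualObjective]
  split_ifs with hc
  · rw [EReal.coe_le_coe_iff]
    have h1 := h.dualValue_add hg hc.1
      ((memLp_two_iff_integrable_sq φ'.continuous.aestronglyMeasurable).2 hc.2.1) hc.2.2
    have h2 : 0 ≤ ∫ p, bregmanGap ε φ ψ φ' ψ' p ∂(lebesgueOn Ω).prod σ :=
      integral_nonneg fun p => bregmanGap_nonneg hε p
    have h3 : 0 ≤ f ^ 2 / (2 * g) * (∫ X, (φ' X - φ X) ^ 2 ∂lebesgueOn Ω) :=
      mul_nonneg (by positivity) (integral_nonneg fun X => sq_nonneg _)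
    change dualValue σ f g ε φ' ψ' ≤ _
    linarith
  · exact bot_le

theorem eq_of_isDualMaximiser [IsFiniteMeasure (lebesgueOn Ω)] [NeZero (lebesgueOn Ω)]
    [(lebesgueOn Ω).IsOpenPosMeasure] [IsFiniteMeasure σ] (hf : f ≠ 0) (hg : 0 < g)
    (hε : 0 < ε) (h : IsEquilibrium σ f g ε φ ψ) (h' : IsDualMaximiser σ f g ε φ' ψ') :
    φ' = φ ∧ Set.EqOn ψ' ψ σ.support := by
  have hle := h' φ ψ
  rw [h.dualObjective_eq, dualObjective] at hle
  -- The value at `(φ, ψ)` is finite, so a maximiser cannot fall in the `⊥` branch.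
  split_ifs at hle with hc
  swap
  · exact absurd hle (not_le.2 (EReal.bot_lt_coe _))
  rw [EReal.coe_le_coe_iff] at hle
  have hφ'2 := (memLp_two_iff_integrable_sq φ'.continuous.aestronglyMeasurable).2 hc.2.1
  have h1 := h.dualValue_add hg hc.1 hφ'2 hc.2.2
  have h2 : 0 ≤ ∫ p, bregmanGap ε φ ψ φ' ψ' p ∂(lebesgueOn Ω).prod σ :=
    integral_nonneg fun p => bregmanGap_nonneg hε p
  have h3 : 0 ≤ ∫ X, (φ' X - φ X) ^ 2 ∂lebesgueOn Ω := integral_nonneg fun X => sq_nonneg _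
  have hpos : 0 < f ^ 2 / (2 * g) := by positivity
  change dualValue σ f g ε φ ψ ≤ dualValue σ f g ε φ' ψ' at hle
  have h4 : ∫ X, (φ' X - φ X) ^ 2 ∂lebesgueOn Ω = 0 := by
    refine le_antisymm (nonpos_of_mul_nonpos_right ?_ hpos) h3
    linarith
  have h5 : ∫ p, bregmanGap ε φ ψ φ' ψ' p ∂(lebesgueOn Ω).prod σ = 0 := by
    have := mul_nonneg hpos.le h3
    linarith
  rw [integral_eq_zero_iff_of_nonneg (fun p => bregmanGap_nonneg hε p)
    (h.integral_bregmanGap hc.1 (h.integrable_mul_waterHeight hφ'2) hc.2.2).1] at h5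
  have hφ : φ' = φ := by
    have h6 := ae_eq_of_integral_sub_sq_eq_zero hφ'2 h.memLp h4
    exact DFunLike.coe_injective (Measure.eq_of_ae_eq h6 φ'.continuous φ.continuous)
  refine ⟨hφ, eqOn_support_of_ae_eq ?_⟩
  -- A vanishing gap gives `φ' + ψ' = φ + ψ` almost everywhere for the product; with `φ' = φ`, a
  -- single good section in `X` determines `ψ'`.
  obtain ⟨X, hX⟩ := (Measure.ae_ae_of_ae_prod h5).exists
  filter_upwards [hX] with Y hY
  have := eq_of_bregmanGap_eq_zero hε hY
  rw [hφ] at this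
  exact add_left_cancel this

theorem entropicOT_eq [IsFiniteMeasure (lebesgueOn Ω)] [IsFiniteMeasure σ] (hε : 0 < ε)
    (h : IsEquilibrium σ f g ε φ ψ) :
    entropicOT σ ε (waterHeight f g φ) = otObjective σ ε (waterHeight f g φ) φ ψ := by
  refine le_antisymm (iSup₂_le fun φ' ψ' => ?_) (le_iSup₂_of_le φ ψ le_rfl)
  rw [h.otObjective_eq h.memLp_waterHeight, otObjective]
  split_ifs with hc
  · rw [EReal.coe_le_coe_iff]
    have h1 := (h.integral_bregmanGap hc.1 hc.2.1 hc.2.2).2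
    have h2 : 0 ≤ ∫ p, bregmanGap ε φ ψ φ' ψ' p ∂(lebesgueOn Ω).prod σ :=
      integral_nonneg fun p => bregmanGap_nonneg hε p
    change otValue σ ε (waterHeight f g φ) φ' ψ' ≤ _
    linarith
  · exact bot_le

theorem primalEnergy_eq [IsFiniteMeasure (lebesgueOn Ω)] [IsFiniteMeasure σ] (hε : 0 < ε)
    (h : IsEquilibrium σ f g ε φ ψ) :
    primalEnergy σ f g ε (waterHeight f g φ) =
      ((otValue σ ε (waterHeight f g φ) φ ψ +
        g / (2 * f ^ 2) * ∫ X, waterHeight f g φ X ^ 2 ∂lebesgueOn Ω : ℝ) : EReal) := by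
  rw [primalEnergy, if_pos h.memLp_waterHeight, h.entropicOT_eq hε,
    h.otObjective_eq h.memLp_waterHeight, EReal.coe_add]

/-- The energy of `η` exceeds that of the water height by at least a quadratic amount. -/
theorem add_sq_le_primalEnergy [IsFiniteMeasure (lebesgueOn Ω)] [IsFiniteMeasure σ]
    (hf : f ≠ 0) (hg : 0 < g) (hε : 0 < ε) (h : IsEquilibrium σ f g ε φ ψ) {η : Ω → ℝ}
    (hη : MemLp η 2 (lebesgueOn Ω)) :
    primalEnergy σ f g ε (waterHeight f g φ) +
      ((g / (2 * f ^ 2) * ∫ X, (η X - waterHeight f g φ X) ^ 2 ∂lebesgueOn Ω : ℝ) : EReal) ≤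
      primalEnergy σ f g ε η := by
  -- `(φ, ψ)` is one competitor in the supremum, so it bounds `OT_ε` below by an affine function of
  -- `η`. Adding the quadratic term gives a parabola with vertex at the water height, because `φ =
  -- -(g / f²) h`.
  have hle : (otValue σ ε η φ ψ : EReal) ≤ entropicOT σ ε η := by
    rw [← h.otObjective_eq hη]
    exact le_iSup₂_of_le φ ψ le_rfl
  have e1 := integral_sub_sq hη h.memLp_waterHeight
  have e2 : ∀ ρ : Ω → ℝ, ∫ X, φ X * ρ X ∂lebesgueOn Ω =
      -(g / f ^ 2) * ∫ X, ρ X * waterHeight f g φ X ∂lebesgueOn Ω := by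
    intro ρ
    rw [← integral_const_mul]
    congr 1 with X
    rw [waterHeight]
    field_simp
  rw [h.primalEnergy_eq hε, primalEnergy, if_pos hη, ← EReal.coe_add]
  refine le_trans (le_of_eq ?_) (add_le_add_left hle _)
  rw [← EReal.coe_add, EReal.coe_eq_coe_iff, e1, otValue, otValue, e2, e2]
  simp only [← sq]
  field_simp
  ring

theorem primalEnergy_le [IsFiniteMeasure (lebesgueOn Ω)] [IsFiniteMeasure σ]
    (hf : f ≠ 0) (hg : 0 < g) (hε : 0 < ε) (h : IsEquilibrium σ f g ε φ ψ) (η : Ω → ℝ) :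
    primalEnergy σ f g ε (waterHeight f g φ) ≤ primalEnergy σ f g ε η := by
  by_cases hη : MemLp η 2 (lebesgueOn Ω)
  · refine le_trans ?_ (h.add_sq_le_primalEnergy hf hg hε hη)
    refine le_add_of_nonneg_right (EReal.coe_nonneg.2 ?_)
    exact mul_nonneg (by positivity) (integral_nonneg fun X => sq_nonneg _)
  · conv_rhs => rw [primalEnergy, if_neg hη]
    exact le_top

theorem ae_eq_waterHeight [IsFiniteMeasure (lebesgueOn Ω)] [IsFiniteMeasure σ]
    (hf : f ≠ 0) (hg : 0 < g) (hε : 0 < ε) (h : IsEquilibrium σ f g ε φ ψ) {η : Ω → ℝ}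
    (hle : primalEnergy σ f g ε η ≤ primalEnergy σ f g ε (waterHeight f g φ)) :
    η =ᵐ[lebesgueOn Ω] waterHeight f g φ := by
  by_cases hη : MemLp η 2 (lebesgueOn Ω)
  · have h1 := (h.add_sq_le_primalEnergy hf hg hε hη).trans hle
    rw [h.primalEnergy_eq hε, ← EReal.coe_add, EReal.coe_le_coe_iff, add_le_iff_nonpos_right] at h1
    have h2 : ∫ X, (η X - waterHeight f g φ X) ^ 2 ∂lebesgueOn Ω = 0 :=
      le_antisymm (nonpos_of_mul_nonpos_right h1 (by positivity))
        (integral_nonneg fun X => sq_nonneg _)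
    exact ae_eq_of_integral_sub_sq_eq_zero hη h.memLp_waterHeight h2
  · rw [h.primalEnergy_eq hε, primalEnergy, if_neg hη] at hle
    exact absurd hle (not_le.2 (EReal.coe_lt_top _))

theorem measurable_ofReal_planDensity (ε : ℝ) (φ : C(Ω, ℝ))
    (ψ : C(EuclideanSpace ℝ (Fin d), ℝ)) :
    Measurable fun p : Ω × EuclideanSpace ℝ (Fin d) =>
      ENNReal.ofReal (planDensity ε φ ψ p.1 p.2) :=
  (continuous_planDensity ε φ ψ).measurable.ennreal_ofReal

/-- By Tonelli, since for every `Y` the density in `X` has mass one. -/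
theorem snd_entropicPlan [IsFiniteMeasure (lebesgueOn Ω)] [IsFiniteMeasure σ]
    (h : IsEquilibrium σ f g ε φ ψ) : (entropicPlan σ ε φ ψ).snd = σ := by
  ext B hB
  have hm := measurable_ofReal_planDensity ε φ ψ
  rw [Measure.snd_apply hB, entropicPlan, withDensity_apply _ (measurable_snd hB),
    ← Set.univ_prod, ← Measure.prod_restrict, Measure.restrict_univ,
    lintegral_prod_symm _ hm.aemeasurable]
  have h1 : ∀ Y, ∫⁻ X, ENNReal.ofReal (planDensity ε φ ψ X Y) ∂lebesgueOn Ω = 1 := by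
    intro Y
    rw [← ofReal_integral_eq_lintegral_ofReal (h.integrable_section Y)
      (Filter.Eventually.of_forall fun X => (planDensity_pos _ _ _ _ _).le), h.integral_fst,
      ENNReal.ofReal_one]
  simp [h1]

theorem isBarycentricMap [IsFiniteMeasure (lebesgueOn Ω)] [IsFiniteMeasure σ]
    (hΩ : Bornology.IsBounded Ω) (h : IsEquilibrium σ f g ε φ ψ) :
    IsBarycentricMap (entropicPlan σ ε φ ψ) (barycentre ε φ ψ) := by
  obtain ⟨R, hR⟩ := hΩ.exists_norm_le
  have hi : Integrable (fun p : Ω × EuclideanSpace ℝ (Fin d) =>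
      planDensity ε φ ψ p.1 p.2 • (p.1 : EuclideanSpace ℝ (Fin d))) ((lebesgueOn Ω).prod σ) :=
    h.integrable.smul_bdd R (continuous_subtype_val.comp continuous_fst).aestronglyMeasurable
      (Filter.Eventually.of_forall fun p => hR p.1 p.1.2)
  refine ⟨?_, fun B hB => ?_⟩
  · rw [h.snd_entropicPlan]
    exact hi.integral_prod_right
  · rw [h.snd_entropicPlan, entropicPlan, setIntegral_withDensity_eq_setIntegral_toReal_smul
      (measurable_ofReal_planDensity ε φ ψ)
      (Filter.Eventually.of_forall fun p => ENNReal.ofReal_lt_top) _ (measurable_snd hB),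
      ← Set.univ_prod]
    simp only [ENNReal.toReal_ofReal (planDensity_pos _ _ _ _ _).le]
    have hi' := hi.integrableOn (s := Set.univ ×ˢ B)
    rw [IntegrableOn, ← Measure.prod_restrict, Measure.restrict_univ] at hi'
    rw [← Measure.prod_restrict, Measure.restrict_univ, integral_prod_symm _ hi']
    rfl

end IsEquilibrium

end Optimality

end

end EntropicSWSG

/-! ### The theorem assembled -/

open EntropicSWSG in
theorem mainTheorem3 {d : ℕ} (Ω : Set (EuclideanSpace ℝ (Fin d)))
    (hΩ_open : IsOpen Ω) (hΩ_convex : Convex ℝ Ω) (hΩ_bdd : Bornology.IsBounded Ω)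
    (hΩ_ne : Ω.Nonempty)
    (σ : MeasureTheory.Measure (EuclideanSpace ℝ (Fin d)))
    [MeasureTheory.IsProbabilityMeasure σ]
    (hσ : MeasureTheory.Integrable (fun Y => ‖Y‖ ^ 2) σ)
    (f g ε : ℝ) (hf : f ≠ 0) (hg : 0 < g) (hε : 0 < ε) :
    ∃ (φ : C(Ω, ℝ)) (ψ : C(EuclideanSpace ℝ (Fin d), ℝ)),
      -- existence and uniqueness of the maximiser (`ψ` is seen by the problem on `supp σ` only)
      IsDualMaximiser σ f g ε φ ψ ∧
      (∀ (φ' : C(Ω, ℝ)) (ψ' : C(EuclideanSpace ℝ (Fin d), ℝ)),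
        IsDualMaximiser σ f g ε φ' ψ' → φ' = φ ∧ Set.EqOn ψ' ψ σ.support) ∧
      -- (i) optimality conditions
      (∀ (φ' : C(Ω, ℝ)) (ψ' : C(EuclideanSpace ℝ (Fin d), ℝ)),
        IsDualMaximiser σ f g ε φ' ψ' ↔
          (∀ Y ∈ σ.support, LogSumExpEquation ε φ' ψ' Y) ∧
          (∀ X, LambertEquation σ f g ε φ' ψ' X)) ∧
      (∀ Y, LogSumExpEquation ε φ ψ Y) ∧
      (∀ X, LambertEquation σ f g ε φ ψ X) ∧
      (∀ (φ' : C(Ω, ℝ)) (ψ' : C(EuclideanSpace ℝ (Fin d), ℝ)),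
        (∀ Y, LogSumExpEquation ε φ' ψ' Y) → (∀ X, LambertEquation σ f g ε φ' ψ' X) →
          φ' = φ ∧ ψ' = ψ) ∧
      -- (ii) the water height is a probability density, the potentials solve the entropic
      -- transport problem towards it, and it is the unique solution of the primal problem
      (∀ X, 0 ≤ waterHeight f g φ X) ∧
      (∫ X, waterHeight f g φ X ∂(lebesgueOn Ω) = 1) ∧
      entropicOT σ ε (waterHeight f g φ) = otObjective σ ε (waterHeight f g φ) φ ψ ∧
      (∀ h : Ω → ℝ, primalEnergy σ f g ε (waterHeight f g φ) ≤ primalEnergy σ f g ε h) ∧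
      (∀ h : Ω → ℝ, primalEnergy σ f g ε h ≤ primalEnergy σ f g ε (waterHeight f g φ) →
        h =ᵐ[lebesgueOn Ω] waterHeight f g φ) ∧
      -- (iii) gradient of `ψ` and barycentric map
      (∀ Y, HasGradientAt ψ (Y - barycentre ε φ ψ Y) Y) ∧
      (∀ Y, ∫ X, planDensity ε φ ψ X Y ∂(lebesgueOn Ω) = 1) ∧
      (entropicPlan σ ε φ ψ).snd = σ ∧
      IsBarycentricMap (entropicPlan σ ε φ ψ) (barycentre ε φ ψ) := by
  have := isFiniteMeasure_lebesgueOn hΩ_open hΩ_bdd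
  have := isOpenPosMeasure_lebesgueOn hΩ_open
  have : Nonempty Ω := hΩ_ne.to_subtype
  have : NeZero (lebesgueOn Ω) :=
    ⟨Measure.measure_univ_pos.1 (isOpen_univ.measure_pos _ Set.univ_nonempty)⟩
  have hK := isGibbsLike_kernelOn hΩ_bdd hσ hε
  obtain ⟨φ, ψ, hψ, hφ, hφ2⟩ := exists_solution hΩ_open hΩ_convex hΩ_bdd hK hf hg hε
  have heq := isEquilibrium_of_equations hK hf hg hε hψ hφ hφ2
  have huniq := fun φ' ψ' (h : IsDualMaximiser σ f g ε φ' ψ') =>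
    heq.eq_of_isDualMaximiser hf hg hε h
  have hmax := heq.isDualMaximiser hg hε
  refine ⟨φ, ψ, hmax, huniq, fun φ' ψ' => ⟨fun h => ?_, fun h => ?_⟩, hψ, hφ,
    fun φ' ψ' hψ' hφ' => ?_, heq.waterHeight_nonneg, heq.integral_waterHeight,
    heq.entropicOT_eq hε, heq.primalEnergy_le hf hg hε,
    fun η hη => heq.ae_eq_waterHeight hf hg hε hη,
    hasGradientAt_of_logSumExp hΩ_bdd hK hε heq.nonpos hψ, heq.integral_fst,
    heq.snd_entropicPlan, heq.isBarycentricMap hΩ_bdd⟩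
  -- A maximiser differs from the solution only in `ψ` off the support, which neither equation sees.
  · obtain ⟨rfl, h2⟩ := huniq φ' ψ' h
    refine ⟨fun Y hY => ?_, fun X => (lambertEquation_congr (ae_eq_of_eqOn_support h2) X).2 (hφ X)⟩
    rw [LogSumExpEquation, h2 hY]
    exact hψ Y
  -- Conversely the comparison principle identifies `φ'`, the first equation then fixes `ψ'` on the
  -- support, and the objective depends on `ψ'` only there.
  · obtain rfl := eq_of_equations hK hf hg hε (fun Y _ => hψ Y) hφ h.1 h.2
    have h2 : Set.EqOn ψ' ψ σ.support := fun Y hY => (h.1 Y hY).trans (hψ Y).symm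
    intro φ'' ψ''
    rw [dualObjective_congr (ae_eq_of_eqOn_support h2)]
    exact hmax φ'' ψ''
  · obtain rfl := eq_of_equations hK hf hg hε (fun Y _ => hψ Y) hφ (fun Y _ => hψ' Y) hφ'
    exact ⟨rfl, ContinuousMap.ext fun Y => (hψ' Y).trans (hψ Y).symm⟩
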